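/- Consider $N_f\ge 1$ files of size $F$, requested with the Zipf probabilities $p_r(i)=i^{-\beta}/\sum_{k=1}^{N_f}k^{-\beta}$. Users have density $\lambda>0$ and each caches one file, file $i$ with probability $p_c(i)\ge 0$, $\sum_i p_c(i)=1$; the users caching file $i$ (its helpers) form a homogeneous Poisson point process (PPP) of density $\lambda_i=\lambda p_c(i)$. A user requesting file $i$ (the receiver, at the origin) is served by its nearest helper of file $i$ if this helper is at distance $r$ less than the collaboration distance $r_c>0$; otherwise nothing is offloaded. In the full-reuse case all transmitters (active helpers) send simultaneously: the transmitters of file $k$ form a PPP of density $$\lambda_k^d=\lambda_k\Bigl(1-\bigl(1+\tfrac{\lambda p_r(k)}{3.5\lambda_k}\bigr)^{-3.5}\theta_k\Bigr),\qquad \theta_k=\frac{\Gamma(3.5,0)-\Gamma\bigl(3.5,(3.5\lambda_k+\lambda p_r(k))\pi r_c^2\bigr)}{\Gamma(3.5,0)-\Gamma(3.5,3.5\lambda_k\pi r_c^2)}$$ ($\lambda_k^d=0$ if $\lambda_k=0$; $\Gamma(\cdot,\cdot)$ is the upper incomplete gamma function), independently for distinct files. For a receiver of file $i$ served from distance $r$,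 the interferers are all transmitters of the other files and the transmitters of file $i$ at distance greater than $r$. All channel gains are i.i.d. exponential with mean $1$, independent of the transmitters. With path loss exponent $\alpha>2$, noise variance $\sigma^2>0$, transmit power $P_t>0$, $\sigma_0^2=\sigma^2/P_t$, and normalized interference $I_{i,r}=\sum_j h_jr_j^{-\alpha}$ over the interferers, let $$\gamma_1=\frac{hr^{-\alpha}}{I_{i,r}+\sigma_0^2},\quad R_1=W\log_2(1+\gamma_1),\quad E_1=\frac{F}{R_1}\Bigl(\frac{P_t}{\eta}+P_c\Bigr),\quad \delta_1=\min\Bigl(\frac{R_1\,\rho V_0Q}{F(P_t/\eta+P_c)},1\Bigr),$$ where $F,W,Q,V_0,\eta,\rho>0$, $P_c\ge 0$, and $\rho V_0Q$ is the energy a transmitter may spend on one file. The offloading opportunity $p_o$ is the probability that the requested file has a helper at distance less than $r_c$; the offloading probability $p_1$ is the probability that, moreover, $E_1\le\rho V_0Q$ (complete transmission); the offloading ratio $p_1^a$ is the mean fraction of the requested file delivered by complete or partial D2D transmission, i.e. the mean of $\delta_1$, counted as $0$ if no helper is at distance less than $r_c$. Then $$p_1^a=\sum_{i=1}^{N_f}p_r(i)\int_0^{r_c}\frac{f_i(r)}{\ln(1+\Gamma_1)}\int_0^{\Gamma_1}\frac{e^{-\phi_i(t,r)}}{1+t}\,dt\,dr,$$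 where $\Gamma_1=\exp\bigl(\frac{F(P_t+\eta P_c)\ln 2}{W\rho QV_0\eta}\bigr)-1$, $f_i(r)=2\pi r\lambda_ie^{-\lambda_i\pi r^2}$, $\lambda_I=\sum_k\lambda_k^d$, and $$\phi_i(x,y)=xy^\alpha\sigma_0^2+\pi\bigl(\lambda_I\xi_1-\lambda_i^d\xi_2(x)\bigr)y^2x^{2/\alpha},\quad \xi_1=\int_0^\infty\frac{dt}{1+t^{\alpha/2}},\quad \xi_2(x)=\int_0^{x^{-2/\alpha}}\frac{dt}{1+t^{\alpha/2}}.$$ Moreover $p_1\le p_1^a\le p_o$, and both become equalities in the limit in each of two cases. (a) As $\rho\to\infty$ with all else fixed, $p_1\to p_o$ and $p_1^a\to p_o$. (b) As the SNR tends to infinity and the density of transmitters tends to $0$, that is $r_c^\alpha\sigma_0^2\to0$ and $\lambda_I\to0$ with $N_f,r_c,\alpha,F,W,Q,V_0,\eta,P_t,P_c,\rho$ fixed, $p_o-p_1\to0$ and $p_o-p_1^a\to0$, uniformly in $\lambda$, $\beta$, $p_c$; here the transmitter densities $\lambda_k^d\ge0$ may be arbitrary numbers with sum $\lambda_I$, not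 only those given by the formula above. -/

import Mathlib

open MeasureTheory ProbabilityTheory Filter Topology
open scoped ENNReal

noncomputable section

namespace D2D

/-- The plane, with its Euclidean norm and Lebesgue measure. -/
abbrev Plane := EuclideanSpace ℝ (Fin 2)

/-! ### Poisson point processes -/

/-- A random, finite or infinite, enumerated collection of points of the plane: for the outcome `ω`
the points are `pt j ω` for those `j : ℕ` with `j < count ω`. -/
structure PointSeq (Ω : Type*) where
  count : Ω → ℕ∞
  pt : ℕ → Ω → Plane

namespace PointSeq

variable {Ω : Type*}

/-- The number of points that lie in `B`. -/
def number (Φ : PointSeq Ω) (B : Set Plane) (ω : Ω) : ℕ∞ :=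
  {j : ℕ | (j : ℕ∞) < Φ.count ω ∧ Φ.pt j ω ∈ B}.encard

/-- The distance from the origin to the nearest point (`∞` if there is no point). -/
def nearest (Φ : PointSeq Ω) (ω : Ω) : ℝ≥0∞ :=
  ⨅ (j : ℕ) (_ : (j : ℕ∞) < Φ.count ω), ENNReal.ofReal ‖Φ.pt j ω‖

/-- All the data of the point process, as one random element. -/
def toElement (Φ : PointSeq Ω) (ω : Ω) : ℕ∞ × (ℕ → Plane) :=
  (Φ.count ω, fun j => Φ.pt j ω)

/-- `Φ` is a homogeneous Poisson point process of density `d` on the plane: the number of points in a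
Borel set of finite area `a` has the Poisson distribution of mean `d * a`, and the numbers of points
in pairwise disjoint Borel sets are independent. -/
structure IsPoisson [MeasurableSpace Ω] (Φ : PointSeq Ω) (d : ℝ) (μ : Measure Ω) : Prop where
  measurable_count : Measurable Φ.count
  measurable_pt : ∀ j, Measurable (Φ.pt j)
  law : ∀ B : Set Plane, MeasurableSet B → volume B ≠ ∞ → ∀ n : ℕ,
    μ.real {ω | Φ.number B ω = n} =
      Real.exp (-(d * volume.real B)) * (d * volume.real B) ^ n / (n.factorial : ℝ)
  indep : ∀ (m : ℕ) (B : Fin m → Set Plane), (∀ l, MeasurableSet (B l)) →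
    Pairwise (fun l l' => Disjoint (B l) (B l')) →
      iIndepFun (fun l => Φ.number (B l)) μ

end PointSeq

/-! ### Parameters of the system -/

/-- The deterministic parameters. The files are indexed by `Fin N`; the file with index `i : Fin N` is
the `(i + 1)`-st most popular one. -/
structure Params (N : ℕ) where
  /-- Zipf exponent of the file popularity -/
  beta : ℝ
  /-- density of the users -/
  lam : ℝ
  /-- caching distribution: probability that a user caches the given file -/
  pc : Fin N → ℝ
  /-- collaboration distance -/
  rc : ℝ
  /-- path loss exponent -/
  alpha : ℝ
  /-- file size -/
  F : ℝ
  /-- bandwidth -/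
  W : ℝ
  /-- battery capacity -/
  Q : ℝ
  /-- operating voltage -/
  V0 : ℝ
  /-- power amplifier efficiency -/
  eta : ℝ
  /-- transmit power -/
  Pt : ℝ
  /-- circuit power -/
  Pc : ℝ
  /-- noise variance -/
  sigmaSq : ℝ
  /-- fraction of the battery energy that may be spent on one file -/
  rho : ℝ

namespace Params

variable {N : ℕ}

/-- The admissible parameters. -/
structure Valid (S : Params N) : Prop where
  lam_pos : 0 < S.lam
  pc_nonneg : ∀ i, 0 ≤ S.pc i
  pc_sum : ∑ i, S.pc i = 1
  rc_pos : 0 < S.rc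
  two_lt_alpha : 2 < S.alpha
  F_pos : 0 < S.F
  W_pos : 0 < S.W
  Q_pos : 0 < S.Q
  V0_pos : 0 < S.V0
  eta_pos : 0 < S.eta
  Pt_pos : 0 < S.Pt
  Pc_nonneg : 0 ≤ S.Pc
  sigmaSq_pos : 0 < S.sigmaSq
  rho_pos : 0 < S.rho

/-- Zipf distribution of the requests. -/
def pr (S : Params N) (i : Fin N) : ℝ :=
  ((i : ℝ) + 1) ^ (-S.beta) / ∑ k : Fin N, ((k : ℝ) + 1) ^ (-S.beta)

/-- Density of the helpers that cache the file `i`. -/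
def lamFile (S : Params N) (i : Fin N) : ℝ := S.lam * S.pc i

/-- Noise variance normalized by the transmit power. -/
def sigma0Sq (S : Params N) : ℝ := S.sigmaSq / S.Pt

/-- Battery energy that may be spent on one file. -/
def budget (S : Params N) : ℝ := S.rho * S.V0 * S.Q

/-- Upper incomplete gamma function. -/
def upperGamma (s x : ℝ) : ℝ := ∫ t in Set.Ioi x, t ^ (s - 1) * Real.exp (-t)

/-- The factor `θ_i` in the density of the transmitters. -/
def theta (S : Params N) (i : Fin N) : ℝ :=
  (upperGamma 3.5 0
      - upperGamma 3.5 ((3.5 * S.lamFile i + S.lam * S.pr i) * (Real.pi * S.rc ^ 2))) /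
    (upperGamma 3.5 0 - upperGamma 3.5 (3.5 * S.lamFile i * (Real.pi * S.rc ^ 2)))

/-- Density `λ_i^d` of the transmitters (active helpers) that cache the file `i`; it is `0` for a file
that is never cached. -/
def dtDensity (S : Params N) (i : Fin N) : ℝ :=
  S.lamFile i *
    (1 - (1 + S.lam * S.pr i / (3.5 * S.lamFile i)) ^ (-(3.5 : ℝ)) * S.theta i)

/-- The SINR threshold `Γ₁`. -/
def Gamma1 (S : Params N) : ℝ :=
  Real.exp (S.F * (S.Pt + S.eta * S.Pc) * Real.log 2 / (S.W * S.rho * S.Q * S.V0 * S.eta)) - 1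

/-- The function `f_i`. -/
def linkPdf (S : Params N) (i : Fin N) (r : ℝ) : ℝ :=
  2 * Real.pi * r * S.lamFile i * Real.exp (-(S.lamFile i * Real.pi * r ^ 2))

/-- The constant `ξ₁`. -/
def xi1 (S : Params N) : ℝ := ∫ t in Set.Ioi (0 : ℝ), 1 / (1 + t ^ (S.alpha / 2))

/-- The function `ξ₂` of `x`. -/
def xi2 (S : Params N) (x : ℝ) : ℝ :=
  ∫ t in (0 : ℝ)..(x ^ (-(2 / S.alpha))), 1 / (1 + t ^ (S.alpha / 2))

/-- The function `φ_i(x, y)`, for transmitter densities `d`. -/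
def phi (S : Params N) (d : Fin N → ℝ) (i : Fin N) (x y : ℝ) : ℝ :=
  x * y ^ S.alpha * S.sigma0Sq
    + Real.pi * ((∑ k, d k) * S.xi1 - d i * S.xi2 x) * y ^ 2 * x ^ (2 / S.alpha)

end Params

/-! ### The random network, seen from a receiver at the origin -/

/-- The random ingredients: for every file `k` the helpers that cache it and the transmitters that are
sending it, and the channel power gains. `gain none` is the gain of the desired link and
`gain (some (k, j))` that of the channel from the `j`-th transmitter of the file `k`. -/
structure Network (N : ℕ) (Ω : Type*) where
  helper : Fin N → PointSeq Ω
  dt : Fin N → PointSeq Ω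
  gain : Option (Fin N × ℕ) → Ω → ℝ

namespace Network

variable {N : ℕ} {Ω : Type*}

/-- The probabilistic model: the helpers of the file `k` form a Poisson point process of density `λ_k`,
the transmitters of the file `k` a Poisson point process of density `d k`, independently for distinct
files, and the channel gains are independent, exponential with mean one (Rayleigh fading), and
independent of the transmitters. -/
structure Follows [MeasurableSpace Ω] (net : Network N Ω) (S : Params N) (d : Fin N → ℝ)
    (μ : Measure Ω) : Prop where
  helper_poisson : ∀ k, (net.helper k).IsPoisson (S.lamFile k) μ
  dt_poisson : ∀ k, (net.dt k).IsPoisson (d k) μ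
  dt_indep : iIndepFun (fun k => (net.dt k).toElement) μ
  gain_measurable : ∀ o, Measurable (net.gain o)
  gain_law : ∀ o, HasLaw (net.gain o) (expMeasure 1) μ
  gain_indep : iIndepFun net.gain μ
  gain_dt_indep : IndepFun (fun ω o => net.gain o ω) (fun ω k => (net.dt k).toElement ω) μ

open scoped Classical in
/-- Interference, normalized by the transmit power, at a receiver of the file `i` served from the
distance `r`: the sum of `h * |x| ^ (-α)` over all the other transmitters. As the receiver is served by
the nearest holder of the file `i`, the other transmitters of this file are farther than `r`, whereas
those of the other files can be anywhere. -/
def interference (net : Network N Ω) (S : Params N) (i : Fin N) (r : ℝ) (ω : Ω) : ℝ≥0∞ :=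
  ∑ k : Fin N, ∑' j : ℕ,
    if (j : ℕ∞) < (net.dt k).count ω ∧ (k = i → r < ‖(net.dt k).pt j ω‖) then
      ENNReal.ofReal (net.gain (some (k, j)) ω * ‖(net.dt k).pt j ω‖ ^ (-S.alpha))
    else 0

/-- Signal to interference plus noise ratio `γ₁(i, r)`. -/
def sinr (net : Network N Ω) (S : Params N) (i : Fin N) (r : ℝ) (ω : Ω) : ℝ :=
  (ENNReal.ofReal (net.gain none ω * r ^ (-S.alpha)) /
    (net.interference S i r ω + ENNReal.ofReal S.sigma0Sq)).toReal

/-- Data rate `R₁(i, r)`. -/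
def rate (net : Network N Ω) (S : Params N) (i : Fin N) (r : ℝ) (ω : Ω) : ℝ :=
  S.W * Real.logb 2 (1 + net.sinr S i r ω)

/-- Energy `E₁(i, r)` needed to transmit the whole file (`∞` at rate zero). -/
def energy (net : Network N Ω) (S : Params N) (i : Fin N) (r : ℝ) (ω : Ω) : ℝ≥0∞ :=
  ENNReal.ofReal S.F / ENNReal.ofReal (net.rate S i r ω) *
    ENNReal.ofReal (1 / S.eta * S.Pt + S.Pc)

/-- Fraction `δ₁(i, r)` of the file that is conveyed before the energy budget is exhausted. -/
def fraction (net : Network N Ω) (S : Params N) (i : Fin N) (r : ℝ) (ω : Ω) : ℝ :=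
  min (net.rate S i r ω * (S.budget / (S.F * (1 / S.eta * S.Pt + S.Pc)))) 1

variable [MeasurableSpace Ω]

/-- Probability of a complete transmission over a link of length `r`. -/
def completeProb (net : Network N Ω) (S : Params N) (μ : Measure Ω) (i : Fin N) (r : ℝ) : ℝ :=
  μ.real {ω | net.energy S i r ω ≤ ENNReal.ofReal S.budget}

/-- Mean fraction of the file conveyed over a link of length `r`. -/
def meanFraction (net : Network N Ω) (S : Params N) (μ : Measure Ω) (i : Fin N) (r : ℝ) : ℝ :=
  ∫ ω, net.fraction S i r ω ∂μ

/-- Offloading opportunity: the probability that the requested file is cached by a user within the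
collaboration distance. -/
def offloadOpportunity (net : Network N Ω) (S : Params N) (μ : Measure Ω) : ℝ :=
  ∑ i, S.pr i * μ.real {ω | (net.helper i).nearest ω < ENNReal.ofReal S.rc}

/-- Mean of `g i D` over the requested file `i` and the length `D` of the link to the nearest helper of
the file `i`, where a request that finds no helper within the collaboration distance counts as `0`. -/
def linkMean (net : Network N Ω) (S : Params N) (μ : Measure Ω) (g : Fin N → ℝ → ℝ) : ℝ :=
  ∑ i, S.pr i * ∫ ω in {ω | (net.helper i).nearest ω < ENNReal.ofReal S.rc},
    g i ((net.helper i).nearest ω).toReal ∂μ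

/-- Offloading probability: the probability that the requested file is found within the collaboration
distance and transmitted completely. -/
def offloadProbability (net : Network N Ω) (S : Params N) (μ : Measure Ω) : ℝ :=
  net.linkMean S μ (net.completeProb S μ)

/-- Offloading ratio: the mean fraction of a requested file that is conveyed by complete or partial
device-to-device transmission. -/
def offloadRatio (net : Network N Ω) (S : Params N) (μ : Measure Ω) : ℝ :=
  net.linkMean S μ (net.meanFraction S μ)

end Network

end D2D

end

/-!
Every statement rests on the coverage probability `P(γ₁ ≥ t) = e^{-φ_i(t, r)}` of a link of length
`r` (`Network.Follows.measure_le_sinr`). Writing `γ₁ ≥ t` as `h ≥ t r^α (I + σ₀²)`, the exponential law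
of the desired gain `h` turns the probability into the Laplace transform of `I` at `t r^α`. Averaging
over the remaining gains, with the transmitters fixed, replaces a transmitter at distance `ρ` by the
factor `1 / (1 + s ρ^{-α})`, and the mean of the product of these factors over the transmitters is the
Laplace functional of a Poisson process, `E e^{-∑ f} = e^{-d ∫ (1 - e^{-f})}`
(`PointSeq.IsPoisson.lintegral_expNeg_total`). The latter holds for simple functions, because the counts
of the level sets are independent Poisson variables, and passes to monotone limits. In polar
coordinates, the substitution `t = s^{-2/α} ρ²` gives the constants `ξ₁` and `ξ₂` (`integral_plane`).

The fraction delivered equals `ln (1 + min(γ₁, Γ₁)) / ln (1 + Γ₁)`, so its mean is an integral of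
`P(γ₁ ≥ t) / (1 + t)` over `t ≤ Γ₁`, and a transmission is complete exactly if `γ₁ ≥ Γ₁`. The distance
to the nearest helper has density `f_i` (`PointSeq.IsPoisson.setIntegral_nearest`), which gives the
formula. The inequalities `p₁ ≤ p₁ᵃ ≤ p_o` hold pointwise. Both limits follow from `1 - e^{-φ} ≤ φ`:
`p_o - p₁ ≤ Γ₁ r_c^α σ₀² + π ξ₁ r_c² Γ₁^{2/α} λ_I`
(`Network.Follows.offloadOpportunity_sub_offloadProbability_le`), where `Γ₁ → 0` as `ρ → ∞`, and where
`Γ₁` is fixed and the other factors vanish in the second limit.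
-/

namespace D2D

/-! ### The Laplace kernel on the extended half-line -/

/-- The function `x ↦ e⁻ˣ` on `[0, ∞]`, with `e^{-∞} = 0`. -/
noncomputable def expNeg (x : ℝ≥0∞) : ℝ≥0∞ := EReal.exp (-(x : EReal))

@[simp] lemma expNeg_zero : expNeg 0 = 1 := by simp [expNeg]

@[simp] lemma expNeg_top : expNeg ∞ = 0 := by simp [expNeg]

lemma expNeg_ofReal {x : ℝ} (hx : 0 ≤ x) :
    expNeg (ENNReal.ofReal x) = ENNReal.ofReal (Real.exp (-x)) := by
  rw [expNeg, EReal.coe_ennreal_ofReal, max_eq_left hx, ← EReal.coe_neg, EReal.exp_coe]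

lemma continuous_expNeg : Continuous expNeg :=
  ENNReal.continuous_exp.comp (continuous_neg.comp continuous_coe_ennreal_ereal)

lemma antitone_expNeg : Antitone expNeg := fun _ _ h =>
  EReal.exp_monotone (EReal.neg_le_neg_iff.2 (EReal.coe_ennreal_le_coe_ennreal_iff.2 h))

lemma expNeg_le_one (x : ℝ≥0∞) : expNeg x ≤ 1 := by
  simpa using antitone_expNeg (zero_le (a := x))

@[fun_prop]
lemma measurable_expNeg : Measurable expNeg := continuous_expNeg.measurable

lemma expNeg_add (x y : ℝ≥0∞) : expNeg (x + y) = expNeg x * expNeg y := by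
  rw [expNeg, EReal.coe_ennreal_add, EReal.neg_add (by simp) (by simp), sub_eq_add_neg,
    EReal.exp_add, expNeg, expNeg]

lemma expNeg_sum {ι : Type*} (s : Finset ι) (f : ι → ℝ≥0∞) :
    expNeg (∑ i ∈ s, f i) = ∏ i ∈ s, expNeg (f i) := by
  classical
  induction s using Finset.induction_on with
  | empty => simp
  | insert a s ha ih => rw [Finset.sum_insert ha, Finset.prod_insert ha, expNeg_add, ih]

/-! ### The Laplace functional of a Poisson process -/

namespace PointSeq

variable {Ω : Type*}

open scoped Classical in
/-- The sum of `f` over the points of the process. -/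
noncomputable def total (Φ : PointSeq Ω) (f : Plane → ℝ≥0∞) (ω : Ω) : ℝ≥0∞ :=
  ∑' j : ℕ, if (j : ℕ∞) < Φ.count ω then f (Φ.pt j ω) else 0

open scoped Classical in
/-- The counting measure of the points of the process, which turns the sums over its points into
integrals. -/
noncomputable def pointMeasure (Φ : PointSeq Ω) (ω : Ω) : Measure Plane :=
  Measure.sum fun j : ℕ => if (j : ℕ∞) < Φ.count ω then Measure.dirac (Φ.pt j ω) else 0

lemma lintegral_pointMeasure (Φ : PointSeq Ω) (ω : Ω) {f : Plane → ℝ≥0∞} (hf : Measurable f) :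
    ∫⁻ x, f x ∂Φ.pointMeasure ω = Φ.total f ω := by
  rw [pointMeasure, lintegral_sum_measure, total]
  refine tsum_congr fun j => ?_
  split_ifs <;> simp [lintegral_dirac' _ hf]

lemma total_indicator (Φ : PointSeq Ω) (ω : Ω) (B : Set Plane) :
    Φ.total (B.indicator 1) ω = (Φ.number B ω : ℝ≥0∞) := by
  classical
  rw [total, number, ← ENNReal.tsum_set_one, tsum_subtype _ fun _ => (1 : ℝ≥0∞)]
  refine tsum_congr fun j => ?_
  simp only [Set.indicator_apply, Set.mem_ofPred_eq, ite_and, Pi.one_apply]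

lemma pointMeasure_apply (Φ : PointSeq Ω) (ω : Ω) {B : Set Plane} (hB : MeasurableSet B) :
    Φ.pointMeasure ω B = (Φ.number B ω : ℝ≥0∞) := by
  rw [← total_indicator, ← lintegral_pointMeasure _ _ (measurable_one.indicator hB),
    lintegral_indicator_one hB]

namespace IsPoisson

variable [MeasurableSpace Ω] {Φ : PointSeq Ω} {d : ℝ} {μ : Measure Ω}

lemma measurableSet_lt_count (hΦ : Φ.IsPoisson d μ) (j : ℕ) :
    MeasurableSet {ω | (j : ℕ∞) < Φ.count ω} :=
  hΦ.measurable_count (MeasurableSet.of_discrete (s := Set.Ioi (j : ℕ∞)))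

lemma measurable_total (hΦ : Φ.IsPoisson d μ) {f : Plane → ℝ≥0∞} (hf : Measurable f) :
    Measurable (Φ.total f) := by
  classical
  exact Measurable.tsum fun j =>
    Measurable.ite (hΦ.measurableSet_lt_count j) (hf.comp (hΦ.measurable_pt j)) measurable_const

lemma measurable_number (hΦ : Φ.IsPoisson d μ) {B : Set Plane} (hB : MeasurableSet B) :
    Measurable (Φ.number B) := by
  refine measurable_to_countable' fun n => ?_
  have h : Φ.number B ⁻¹' {n} = Φ.total (B.indicator 1) ⁻¹' {(n : ℝ≥0∞)} := by
    ext ω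
    simp [total_indicator]
  rw [h]
  exact hΦ.measurable_total (measurable_one.indicator hB) (measurableSet_singleton _)

lemma density_nonneg (hΦ : Φ.IsPoisson d μ) : 0 ≤ d := by
  have h := hΦ.law (Metric.ball 0 1) measurableSet_ball measure_ball_lt_top.ne 1
  have hv : 0 < volume.real (Metric.ball (0 : Plane) 1) :=
    ENNReal.toReal_pos (Metric.measure_ball_pos _ _ one_pos).ne' measure_ball_lt_top.ne
  have h0 : 0 ≤ d * volume.real (Metric.ball (0 : Plane) 1) := by
    have h1 := measureReal_nonneg (μ := μ) (s := {ω | Φ.number (Metric.ball 0 1) ω = (1 : ℕ)})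
    rw [h] at h1
    simpa using nonneg_of_mul_nonneg_right (by simpa using h1) (Real.exp_pos _)
  exact nonneg_of_mul_nonneg_left h0 hv

/-- The Laplace transform of the Poisson distribution of a count. -/
lemma lintegral_expNeg_number [IsProbabilityMeasure μ] (hΦ : Φ.IsPoisson d μ) {B : Set Plane}
    (hB : MeasurableSet B) (hvol : volume B ≠ ∞) {c : ℝ} (hc : 0 < c) :
    ∫⁻ ω, expNeg (ENNReal.ofReal c * (Φ.number B ω : ℝ≥0∞)) ∂μ =
      ENNReal.ofReal (Real.exp (-(d * volume.real B * (1 - Real.exp (-c))))) := by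
  set m := d * volume.real B with hm
  have hm0 : 0 ≤ m := mul_nonneg hΦ.density_nonneg measureReal_nonneg
  -- The outcomes with infinitely many points in `B` contribute `e^{-∞} = 0`.
  have key : ∀ ω, expNeg (ENNReal.ofReal c * (Φ.number B ω : ℝ≥0∞)) =
      ∑' n : ℕ, {ω | Φ.number B ω = n}.indicator
        (fun _ => ENNReal.ofReal (Real.exp (-(c * n)))) ω := by
    intro ω
    rcases eq_or_ne (Φ.number B ω) ⊤ with h | h
    · simp [h, ENNReal.mul_top, hc]
    · obtain ⟨n, hn⟩ := ENat.ne_top_iff_exists.1 h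
      rw [tsum_eq_single n]
      · rw [← hn]
        simp only [ENat.toENNReal_coe, Set.indicator_apply, Set.mem_ofPred_eq, ← hn, if_true]
        rw [← expNeg_ofReal (by positivity), ENNReal.ofReal_mul hc.le, ENNReal.ofReal_natCast]
      · intro k hk
        simp [← hn, hk.symm]
  have hmeas : ∀ n : ℕ, MeasurableSet {ω | Φ.number B ω = n} := fun n =>
    hΦ.measurable_number hB (measurableSet_singleton _)
  simp_rw [key]
  rw [lintegral_tsum fun n => (measurable_const.indicator (hmeas n)).aemeasurable]
  have hterm : ∀ n : ℕ, ∫⁻ ω, {ω | Φ.number B ω = n}.indicator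
        (fun _ => ENNReal.ofReal (Real.exp (-(c * n)))) ω ∂μ =
      ENNReal.ofReal (Real.exp (-m) * ((m * Real.exp (-c)) ^ n / (n.factorial : ℝ))) := by
    intro n
    rw [lintegral_indicator_const (hmeas n), ← ofReal_measureReal, hΦ.law B hB hvol n,
      ← ENNReal.ofReal_mul (by positivity), ← hm, mul_pow m, ← Real.exp_nat_mul]
    congr 1
    rw [show (n : ℝ) * -c = -(c * n) by ring]
    ring
  simp_rw [hterm]
  have hsum : HasSum (fun n : ℕ => Real.exp (-m) * ((m * Real.exp (-c)) ^ n / (n.factorial : ℝ)))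
      (Real.exp (-m) * Real.exp (m * Real.exp (-c))) := by
    refine HasSum.mul_left _ ?_
    rw [Real.exp_eq_exp_ℝ]
    exact NormedSpace.expSeries_div_hasSum_exp _
  rw [← ENNReal.ofReal_tsum_of_nonneg (fun n => by positivity) hsum.summable, hsum.tsum_eq,
    ← Real.exp_add]
  ring_nf

/-- The Laplace functional for a simple function: the counts of the level sets are independent. -/
lemma lintegral_expNeg_total_simple [IsProbabilityMeasure μ] (hΦ : Φ.IsPoisson d μ)
    (f : SimpleFunc Plane ℝ≥0∞) (hfin : ∀ x, f x ≠ ∞)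
    (hvol : ∀ c, c ≠ 0 → volume (f ⁻¹' {c}) ≠ ∞) :
    ∫⁻ ω, expNeg (Φ.total f ω) ∂μ =
      expNeg (ENNReal.ofReal d * ∫⁻ x, (1 - expNeg (f x)) ∂volume) := by
  have hd := hΦ.density_nonneg
  have htot : ∀ ω, Φ.total f ω = ∑ c ∈ f.range, c * (Φ.number (f ⁻¹' {c}) ω : ℝ≥0∞) := by
    intro ω
    rw [← lintegral_pointMeasure _ _ f.measurable, SimpleFunc.lintegral_eq_lintegral,
      SimpleFunc.lintegral]
    refine Finset.sum_congr rfl fun c _ => ?_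
    rw [pointMeasure_apply _ _ (f.measurableSet_preimage _)]
  have hvolf : ∫⁻ x, (1 - expNeg (f x)) ∂volume =
      ∑ c ∈ f.range, (1 - expNeg c) * volume (f ⁻¹' {c}) := by
    have h := SimpleFunc.map_lintegral (μ := volume) (fun c => 1 - expNeg c) f
    rw [← h, ← SimpleFunc.lintegral_eq_lintegral]
    rfl
  let e := f.range.equivFin
  have hind : iIndepFun (fun c : f.range => Φ.number (f ⁻¹' {(c : ℝ≥0∞)})) μ := by
    have h1 := hΦ.indep f.range.card (fun l => f ⁻¹' {((e.symm l : f.range) : ℝ≥0∞)})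
      (fun l => f.measurableSet_preimage _) (by
        intro l l' hll
        refine Disjoint.preimage _ (Set.disjoint_singleton.2 fun h => hll ?_)
        exact e.symm.injective (Subtype.ext h))
    have h2 := h1.precomp (g := e) e.injective
    convert! h2 using 2 with c
    simp
  have hind' : iIndepFun (fun (c : f.range) ω =>
      expNeg ((c : ℝ≥0∞) * (Φ.number (f ⁻¹' {(c : ℝ≥0∞)}) ω : ℝ≥0∞))) μ :=
    hind.comp (fun c n => expNeg ((c : ℝ≥0∞) * (n : ℝ≥0∞))) fun c => measurable_from_top
  simp_rw [htot, expNeg_sum]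
  rw [hvolf, Finset.mul_sum, expNeg_sum, ← Finset.prod_coe_sort f.range]
  simp_rw [← Finset.prod_coe_sort f.range]
  rw [lintegral_prod_eq_prod_lintegral_of_indepFun _ _ hind' fun c => by
    exact measurable_from_top.comp (hΦ.measurable_number (f.measurableSet_preimage _))
      (g := fun n : ℕ∞ => expNeg ((c : ℝ≥0∞) * (n : ℝ≥0∞)))]
  refine Finset.prod_congr rfl fun c _ => ?_
  obtain ⟨c, hc⟩ := c
  obtain ⟨x, rfl⟩ := SimpleFunc.mem_range.1 hc
  simp only
  rcases eq_or_ne (f x) 0 with h0 | h0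
  · simp [h0]
  · set r := (f x).toReal with hr
    have hfx : f x = ENNReal.ofReal r := (ENNReal.ofReal_toReal (hfin x)).symm
    have hrpos : 0 < r := ENNReal.toReal_pos h0 (hfin x)
    have he : Real.exp (-r) ≤ 1 := Real.exp_le_one_iff.2 (by linarith)
    have hv := hvol _ h0
    rw [hfx] at hv ⊢
    rw [hΦ.lintegral_expNeg_number (f.measurableSet_preimage _) hv hrpos, expNeg_ofReal hrpos.le,
      ← ENNReal.ofReal_one, ← ENNReal.ofReal_sub _ (Real.exp_pos _).le,
      ← ofReal_measureReal hv, ← ENNReal.ofReal_mul (by linarith), ← ENNReal.ofReal_mul hd,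
      expNeg_ofReal (mul_nonneg hd (mul_nonneg (by linarith) measureReal_nonneg))]
    ring_nf

/-- **The Laplace functional of a Poisson process**: `E e^{-∑ f} = e^{-d ∫ (1 - e^{-f})}`. -/
lemma lintegral_expNeg_total [IsProbabilityMeasure μ] (hΦ : Φ.IsPoisson d μ)
    {f : Plane → ℝ≥0∞} (hf : Measurable f) :
    ∫⁻ ω, expNeg (Φ.total f ω) ∂μ =
      expNeg (ENNReal.ofReal d * ∫⁻ x, (1 - expNeg (f x)) ∂volume) := by
  let g : ℕ → SimpleFunc Plane ℝ≥0∞ := fun n =>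
    (SimpleFunc.eapprox f n).restrict (Metric.ball 0 n)
  have hg : ∀ n x, g n x = (Metric.ball (0 : Plane) n).indicator (SimpleFunc.eapprox f n) x :=
    fun n x => by
      rw [SimpleFunc.restrict_apply _ measurableSet_ball]
  have hmono : ∀ x, Monotone fun n => g n x := by
    intro x m n hmn
    simp only [hg]
    refine (Set.indicator_le_indicator_of_subset (Metric.ball_subset_ball (by exact_mod_cast hmn))
      (fun _ => zero_le) x).trans (Set.indicator_le_indicator ?_)
    exact SimpleFunc.monotone_eapprox f hmn x
  have hlim : ∀ x, Tendsto (fun n => g n x) atTop (𝓝 (f x)) := by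
    intro x
    refine (SimpleFunc.tendsto_eapprox hf x).congr' ?_
    obtain ⟨n₀, hn₀⟩ := exists_nat_gt ‖x‖
    filter_upwards [eventually_ge_atTop n₀] with n hn
    rw [hg, Set.indicator_of_mem]
    simpa using hn₀.trans_le (by exact_mod_cast hn)
  have htot : ∀ ω, Tendsto (fun n => Φ.total (g n) ω) atTop (𝓝 (Φ.total f ω)) := by
    intro ω
    rw [← lintegral_pointMeasure _ _ hf]
    simp_rw [← lintegral_pointMeasure _ _ (g _).measurable]
    exact lintegral_tendsto_of_tendsto_of_monotone (fun n => (g n).measurable.aemeasurable)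
      (ae_of_all _ hmono) (ae_of_all _ hlim)
  have hleft : Tendsto (fun n => ∫⁻ ω, expNeg (Φ.total (g n) ω) ∂μ) atTop
      (𝓝 (∫⁻ ω, expNeg (Φ.total f ω) ∂μ)) := by
    refine tendsto_lintegral_of_dominated_convergence (fun _ => 1)
      (fun n => measurable_expNeg.comp (hΦ.measurable_total (g n).measurable))
      (fun n => ae_of_all _ fun ω => expNeg_le_one _) (by simp) (ae_of_all _ fun ω => ?_)
    exact (continuous_expNeg.tendsto _).comp (htot ω)
  have hcont : Continuous fun y : ℝ≥0∞ => 1 - expNeg y :=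
    (ENNReal.continuous_sub_left ENNReal.one_ne_top).comp continuous_expNeg
  have hright : Tendsto (fun n => ∫⁻ x, (1 - expNeg (g n x)) ∂volume) atTop
      (𝓝 (∫⁻ x, (1 - expNeg (f x)) ∂volume)) := by
    refine lintegral_tendsto_of_tendsto_of_monotone
      (fun n => (hcont.measurable.comp (g n).measurable).aemeasurable)
      (ae_of_all _ fun x m n hmn => ?_) (ae_of_all _ fun x => ?_)
    · exact tsub_le_tsub_left (antitone_expNeg (hmono x hmn)) _
    · exact (hcont.tendsto _).comp (hlim x)
  refine tendsto_nhds_unique hleft ?_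
  have hsimple : ∀ n, ∫⁻ ω, expNeg (Φ.total (g n) ω) ∂μ =
      expNeg (ENNReal.ofReal d * ∫⁻ x, (1 - expNeg (g n x)) ∂volume) := by
    intro n
    refine hΦ.lintegral_expNeg_total_simple (g n) (fun x => ?_) fun c hc => ?_
    · rw [hg]
      exact ((Set.indicator_le_self' (fun _ _ => zero_le) x).trans_lt
        (SimpleFunc.eapprox_lt_top f n x)).ne
    · refine ne_top_of_le_ne_top (measure_ball_lt_top (x := (0 : Plane)) (r := n)).ne
        (measure_mono fun x hx => ?_)
      by_contra hxn
      refine hc ?_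
      rw [← (hx : g n x = c), hg, Set.indicator_of_notMem hxn]
  simp_rw [hsimple]
  exact (continuous_expNeg.tendsto _).comp
    (ENNReal.Tendsto.const_mul hright (Or.inr ENNReal.ofReal_ne_top))

end IsPoisson

end PointSeq

/-! ### Independent exponential gains -/

section Gains

variable {Ω : Type*} [MeasurableSpace Ω] {μ : Measure Ω}

/-- Independent random elements may be averaged one after the other. -/
lemma measure_preimage_of_indepFun [IsProbabilityMeasure μ] {β γ : Type*} [MeasurableSpace β]
    [MeasurableSpace γ] {X : Ω → β} {Y : Ω → γ} (hX : Measurable X) (hY : Measurable Y)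
    (h : IndepFun X Y μ) {s : Set (β × γ)} (hs : MeasurableSet s) :
    μ {ω | (X ω, Y ω) ∈ s} = ∫⁻ ω', μ {ω | (X ω, Y ω') ∈ s} ∂μ := by
  have : IsProbabilityMeasure (μ.map X) := Measure.isProbabilityMeasure_map hX.aemeasurable
  have : IsProbabilityMeasure (μ.map Y) := Measure.isProbabilityMeasure_map hY.aemeasurable
  have h1 : μ {ω | (X ω, Y ω) ∈ s} = μ.map (fun ω => (X ω, Y ω)) s :=
    (Measure.map_apply (hX.prodMk hY) hs).symm
  rw [h1, (indepFun_iff_map_prod_eq_prod_map_map hX.aemeasurable hY.aemeasurable).1 h,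
    Measure.prod_apply_symm hs, lintegral_map (measurable_measure_prodMk_right hs) hY]
  refine lintegral_congr fun ω' => ?_
  rw [Measure.map_apply hX (measurable_prodMk_right hs)]
  rfl

lemma measure_le_exponential {h : Ω → ℝ} (hm : Measurable h) (hlaw : HasLaw h (expMeasure 1) μ)
    (b : ℝ≥0∞) : μ {ω | b ≤ ENNReal.ofReal (h ω)} = expNeg b := by
  have : IsProbabilityMeasure (expMeasure 1) := isProbabilityMeasure_expMeasure one_pos
  have : NullSingletonClass (expMeasure 1) := by
    rw [expMeasure, gammaMeasure]
    infer_instance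
  have : IsProbabilityMeasure μ := hlaw.isProbabilityMeasure
  rcases eq_or_ne b ∞ with rfl | hb
  · simp
  rcases eq_or_ne b 0 with rfl | hb0
  · simp
  lift b to NNReal using hb
  have hbpos : (0 : ℝ) < b := by simpa [pos_iff_ne_zero] using hb0
  have h1 : {ω | (b : ℝ≥0∞) ≤ ENNReal.ofReal (h ω)} = h ⁻¹' Set.Ici (b : ℝ) := by
    ext ω
    simp only [Set.mem_ofPred_eq, Set.mem_preimage, Set.mem_Ici]
    rw [← ENNReal.ofReal_coe_nnreal, ENNReal.ofReal_le_ofReal_iff']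
    constructor
    · rintro (h | h)
      · exact h
      · linarith
    · exact Or.inl
  rw [h1, ← Measure.map_apply hm measurableSet_Ici, hlaw.map_eq, ← measure_congr Ioi_ae_eq_Ici,
    ← Set.compl_Iic, prob_compl_eq_one_sub measurableSet_Iic, ← ofReal_cdf,
    cdf_expMeasure_eq one_pos, if_pos hbpos.le, ← ENNReal.ofReal_one,
    ← ENNReal.ofReal_sub _ (by simp), ← ENNReal.ofReal_coe_nnreal, expNeg_ofReal hbpos.le]
  simp

lemma lintegral_expNeg_exponential {h : Ω → ℝ} (hm : Measurable h)
    (hlaw : HasLaw h (expMeasure 1) μ) {s : ℝ} (hs : 0 ≤ s) :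
    ∫⁻ ω, expNeg (ENNReal.ofReal (s * h ω)) ∂μ = expNeg (ENNReal.ofReal (Real.log (1 + s))) := by
  have hg : Measurable fun x : ℝ => expNeg (ENNReal.ofReal (s * x)) := by fun_prop
  have hd : expMeasure 1 = volume.withDensity (exponentialPDF 1) := rfl
  have hpdf : ∀ r, Measurable (exponentialPDF r) := fun r =>
    (measurable_exponentialPDFReal r).ennreal_ofReal
  rw [← lintegral_map (f := fun x => expNeg (ENNReal.ofReal (s * x))) hg hm, hlaw.map_eq, hd,
    lintegral_withDensity_eq_lintegral_mul _ (hpdf 1) hg]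
  have h2 : ∀ x, (exponentialPDF 1 * fun x => expNeg (ENNReal.ofReal (s * x))) x =
      ENNReal.ofReal (1 + s)⁻¹ * exponentialPDF (1 + s) x := by
    intro x
    rcases lt_or_ge x 0 with hx | hx
    · simp [exponentialPDF_of_neg hx]
    · simp only [Pi.mul_apply]
      rw [exponentialPDF_of_nonneg hx, exponentialPDF_of_nonneg hx,
        expNeg_ofReal (by positivity), ← ENNReal.ofReal_mul (by positivity),
        ← ENNReal.ofReal_mul (by positivity), one_mul, ← Real.exp_add, ← mul_assoc,
        inv_mul_cancel₀ (by positivity), one_mul]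
      ring_nf
  simp_rw [h2]
  rw [lintegral_const_mul _ (hpdf _), lintegral_exponentialPDF_eq_one (by positivity), mul_one,
    expNeg_ofReal (Real.log_nonneg (by linarith)), ← Real.log_inv,
    Real.exp_log (by positivity)]

/-- The Laplace transform of a weighted sum of independent exponential gains. -/
lemma lintegral_expNeg_tsum_exponential {ι : Type*} [Countable ι] {h : ι → Ω → ℝ}
    (hm : ∀ p, Measurable (h p)) (hlaw : ∀ p, HasLaw (h p) (expMeasure 1) μ)
    (hind : iIndepFun h μ) {a : ι → ℝ} (ha : ∀ p, 0 ≤ a p) :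
    ∫⁻ ω, expNeg (∑' p, ENNReal.ofReal (a p * h p ω)) ∂μ =
      expNeg (∑' p, ENNReal.ofReal (Real.log (1 + a p))) := by
  have : IsProbabilityMeasure μ := hind.isProbabilityMeasure
  have hleft : Tendsto (fun s : Finset ι => ∫⁻ ω, expNeg (∑ p ∈ s, ENNReal.ofReal (a p * h p ω)) ∂μ)
      atTop (𝓝 (∫⁻ ω, expNeg (∑' p, ENNReal.ofReal (a p * h p ω)) ∂μ)) := by
    refine tendsto_lintegral_filter_of_dominated_convergence (fun _ => 1)
      (Eventually.of_forall fun s => by fun_prop)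
      (Eventually.of_forall fun s => ae_of_all _ fun ω => expNeg_le_one _) (by simp)
      (ae_of_all _ fun ω => ?_)
    exact (continuous_expNeg.tendsto _).comp ENNReal.summable.hasSum
  refine tendsto_nhds_unique hleft ?_
  have hfin : ∀ s : Finset ι, ∫⁻ ω, expNeg (∑ p ∈ s, ENNReal.ofReal (a p * h p ω)) ∂μ =
      expNeg (∑ p ∈ s, ENNReal.ofReal (Real.log (1 + a p))) := by
    intro s
    simp_rw [expNeg_sum]
    rw [lintegral_prod_eq_prod_lintegral_of_indepFun s
      (fun p ω => expNeg (ENNReal.ofReal (a p * h p ω)))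
      (hind.comp (fun p x => expNeg (ENNReal.ofReal (a p * x))) fun p => by fun_prop)
      fun p => by have := hm p; fun_prop]
    exact Finset.prod_congr rfl fun p _ => lintegral_expNeg_exponential (hm p) (hlaw p) (ha p)
  simp_rw [hfin]
  exact (continuous_expNeg.tendsto _).comp ENNReal.summable.hasSum

lemma indepFun_none_some {ι β : Type*} [MeasurableSpace β] {h : Option ι → Ω → β}
    (hm : ∀ o, Measurable (h o)) (hind : iIndepFun h μ) :
    IndepFun (h none) (fun ω p => h (some p) ω) μ := by
  have h1 := indep_iSup_of_disjoint (fun o => (hm o).comap_le)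
    ((iIndepFun_iff_iIndep _ _ _).1 hind) (S := {none}) (T := {none}ᶜ) disjoint_compl_right
  rw [IndepFun_iff_Indep]
  refine indep_of_indep_of_le_right (indep_of_indep_of_le_left h1 (by simp)) ?_
  rw [MeasurableSpace.pi, MeasurableSpace.comap_iSup]
  refine iSup_le fun p => ?_
  rw [MeasurableSpace.comap_comp]
  exact le_iSup₂_of_le (some p) (by simp) le_rfl

/-- With fixed nonnegative weights `a` for the interferers, the gain of the desired link exceeds
`c` times interference plus noise with a probability that factorizes over the interferers. -/
lemma measure_interference_le_gain {ι : Type*} [Countable ι] {h : Option ι → Ω → ℝ}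
    (hm : ∀ o, Measurable (h o)) (hlaw : ∀ o, HasLaw (h o) (expMeasure 1) μ)
    (hind : iIndepFun h μ) {a : ι → ℝ} (ha : ∀ p, 0 ≤ a p) {c : ℝ} (hc : 0 ≤ c) (b : ℝ≥0∞) :
    μ {ω | ENNReal.ofReal c * ((∑' p, ENNReal.ofReal (a p * h (some p) ω)) + b) ≤
        ENNReal.ofReal (h none ω)} =
      expNeg (ENNReal.ofReal c * b) * expNeg (∑' p, ENNReal.ofReal (Real.log (1 + c * a p))) := by
  have : IsProbabilityMeasure μ := hind.isProbabilityMeasure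
  have hs : MeasurableSet {z : ℝ × (ι → ℝ) |
      ENNReal.ofReal c * ((∑' p, ENNReal.ofReal (a p * z.2 p)) + b) ≤ ENNReal.ofReal z.1} :=
    measurableSet_le (by fun_prop) (by fun_prop)
  have h1 := measure_preimage_of_indepFun (hm none) (measurable_pi_lambda _ fun p => hm (some p))
    (indepFun_none_some hm hind) hs
  simp only [Set.mem_ofPred_eq] at h1
  rw [h1]
  simp_rw [measure_le_exponential (hm none) (hlaw none), mul_add, expNeg_add]
  rw [lintegral_mul_const _ (by fun_prop), mul_comm,
    ← lintegral_expNeg_tsum_exponential (fun p => hm (some p)) (fun p => hlaw (some p))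
      (hind.precomp (Option.some_injective ι)) (fun p => mul_nonneg hc (ha p))]
  simp_rw [← ENNReal.tsum_mul_left, ← ENNReal.ofReal_mul hc, mul_assoc]

end Gains

/-! ### The interference integral in polar coordinates -/

section Integrals

variable {a : ℝ}

lemma one_div_one_add_rpow_nonneg {t : ℝ} (ht : 0 ≤ t) : 0 ≤ 1 / (1 + t ^ a) := by positivity

lemma integrableOn_one_div_one_add_rpow (ha : 1 < a) :
    IntegrableOn (fun t : ℝ => 1 / (1 + t ^ a)) (Set.Ioi 0) := by
  have hm : Measurable fun t : ℝ => 1 / (1 + t ^ a) := by fun_prop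
  rw [← Set.Ioc_union_Ioi_eq_Ioi zero_le_one]
  refine IntegrableOn.union ?_ ?_
  · refine Integrable.mono' (g := fun _ => (1 : ℝ)) (by simp) hm.aestronglyMeasurable
      ((ae_restrict_iff' measurableSet_Ioc).2 (ae_of_all _ fun t ht => ?_))
    have h0 : 0 ≤ t ^ a := Real.rpow_nonneg ht.1.le a
    rw [Real.norm_of_nonneg (one_div_one_add_rpow_nonneg ht.1.le)]
    exact div_le_one_of_le₀ (by linarith) (by linarith)
  · refine Integrable.mono' (integrableOn_Ioi_rpow_of_lt (a := -a) (by linarith) one_pos)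
      hm.aestronglyMeasurable ((ae_restrict_iff' measurableSet_Ioi).2 (ae_of_all _ fun t ht => ?_))
    have ht0 : (0 : ℝ) < t := one_pos.trans ht
    have h0 : 0 < t ^ a := Real.rpow_pos_of_pos ht0 a
    rw [Real.norm_of_nonneg (one_div_one_add_rpow_nonneg ht0.le), Real.rpow_neg ht0.le,
      ← one_div]
    exact one_div_le_one_div_of_le h0 (by linarith)

lemma volume_real_ball_plane {r : ℝ} (hr : 0 ≤ r) :
    volume.real (Metric.ball (0 : Plane) r) = Real.pi * r ^ 2 := by
  rw [measureReal_def, EuclideanSpace.volume_ball_fin_two]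
  simp [hr, Real.pi_pos.le, mul_comm]

variable {α s y : ℝ}

/-- The change of variables `t = s^{-2/α} ρ²`, for the part of the radial integral beyond `y`. -/
lemma radial_subst (hα : 0 < α) (hs : 0 < s) (hy : 0 ≤ y) {ρ : ℝ} (hρ : 0 < ρ) :
    (Set.Ioi y).indicator (fun u => s * u ^ (-α) / (1 + s * u ^ (-α))) ρ =
      (Set.Ioi (s ^ (-(2 / α)) * y ^ 2)).indicator (fun t => 1 / (1 + t ^ (α / 2)))
        (s ^ (-(2 / α)) * ρ ^ (2 : ℝ)) := by
  have hb : 0 < s ^ (-(2 / α)) := Real.rpow_pos_of_pos hs _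
  have hiff : s ^ (-(2 / α)) * ρ ^ (2 : ℝ) ∈ Set.Ioi (s ^ (-(2 / α)) * y ^ 2) ↔ ρ ∈ Set.Ioi y := by
    rw [Set.mem_Ioi, Set.mem_Ioi, mul_lt_mul_iff_right₀ hb, Real.rpow_two,
      pow_lt_pow_iff_left₀ hy hρ.le two_ne_zero]
  by_cases h : ρ ∈ Set.Ioi y
  · rw [Set.indicator_of_mem h, Set.indicator_of_mem (hiff.2 h)]
    have h1 : (s ^ (-(2 / α)) * ρ ^ (2 : ℝ)) ^ (α / 2) = ρ ^ α / s := by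
      rw [Real.mul_rpow hb.le (by positivity), ← Real.rpow_mul hs.le, ← Real.rpow_mul hρ.le,
        show -(2 / α) * (α / 2) = -1 by field_simp, show 2 * (α / 2) = α by ring,
        Real.rpow_neg_one]
      field_simp
    have h2 : 0 < ρ ^ α := Real.rpow_pos_of_pos hρ _
    rw [h1, Real.rpow_neg hρ.le]
    field_simp
    ring
  · rw [Set.indicator_of_notMem h, Set.indicator_of_notMem (mt hiff.1 h)]

lemma integrable_plane (hα : 2 < α) (hs : 0 < s) (hy : 0 ≤ y) :
    Integrable (fun x : Plane =>
      (Set.Ioi y).indicator (fun u => s * u ^ (-α) / (1 + s * u ^ (-α))) ‖x‖) := by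
  have hb : 0 < s ^ (-(2 / α)) := Real.rpow_pos_of_pos hs _
  rw [integrable_fun_norm_addHaar volume
    (f := (Set.Ioi y).indicator (fun u => s * u ^ (-α) / (1 + s * u ^ (-α))))]
  have h1 : IntegrableOn ((Set.Ioi (s ^ (-(2 / α)) * y ^ 2)).indicator
      (fun t => 1 / (1 + t ^ (α / 2)))) (Set.Ioi 0) :=
    (integrableOn_one_div_one_add_rpow (by linarith)).indicator measurableSet_Ioi
  have h2 := (integrableOn_Ioi_comp_mul_left_iff
    ((Set.Ioi (s ^ (-(2 / α)) * y ^ 2)).indicator (fun t => 1 / (1 + t ^ (α / 2)))) 0 hb).2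
      (by simpa using h1)
  have h3 := (integrableOn_Ioi_comp_rpow_iff' _ two_ne_zero).2 h2
  refine h3.congr_fun (fun ρ hρ => ?_) measurableSet_Ioi
  rw [radial_subst (by linarith) hs hy hρ]
  norm_num

lemma integral_plane (hα : 2 < α) (hs : 0 < s) (hy : 0 ≤ y) :
    ∫ x : Plane, (Set.Ioi y).indicator (fun u => s * u ^ (-α) / (1 + s * u ^ (-α))) ‖x‖ =
      Real.pi * s ^ (2 / α) *
        ∫ t in Set.Ioi (s ^ (-(2 / α)) * y ^ 2), 1 / (1 + t ^ (α / 2)) := by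
  have hb : 0 < s ^ (-(2 / α)) := Real.rpow_pos_of_pos hs _
  rw [integral_fun_norm_addHaar volume
    ((Set.Ioi y).indicator (fun u => s * u ^ (-α) / (1 + s * u ^ (-α)))),
    volume_real_ball_plane zero_le_one]
  set G := (Set.Ioi (s ^ (-(2 / α)) * y ^ 2)).indicator (fun t : ℝ => 1 / (1 + t ^ (α / 2)))
    with hG
  have h1 : ∫ ρ in Set.Ioi (0 : ℝ),
        ((2 : ℝ) * ρ ^ ((2 : ℝ) - 1)) • G (s ^ (-(2 / α)) * ρ ^ (2 : ℝ)) =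
      s ^ (2 / α) * ∫ t in Set.Ioi (s ^ (-(2 / α)) * y ^ 2), 1 / (1 + t ^ (α / 2)) := by
    rw [integral_comp_rpow_Ioi_of_pos (g := fun v => G (s ^ (-(2 / α)) * v)) two_pos,
      integral_comp_mul_left_Ioi _ _ hb, mul_zero, hG, setIntegral_indicator measurableSet_Ioi,
      Set.Ioi_inter_Ioi, sup_eq_right.2 (by positivity), smul_eq_mul,
      ← Real.rpow_neg hs.le, neg_neg]
  rw [mul_assoc, ← h1]
  simp only [finrank_euclideanSpace, Fintype.card_fin, smul_eq_mul, nsmul_eq_mul]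
  rw [← integral_const_mul, ← integral_const_mul, ← integral_const_mul]
  refine setIntegral_congr_fun measurableSet_Ioi fun ρ hρ => ?_
  rw [radial_subst (by linarith) hs hy hρ, ← hG]
  norm_num
  ring

end Integrals

namespace Params

variable {N : ℕ} {S : Params N}

lemma integrableOn_xi1 (hα : 2 < S.alpha) :
    IntegrableOn (fun t : ℝ => 1 / (1 + t ^ (S.alpha / 2))) (Set.Ioi 0) :=
  integrableOn_one_div_one_add_rpow (by linarith)

lemma integral_Ioi_eq_xi1_sub_xi2 (hα : 2 < S.alpha) {x : ℝ} (hx : 0 ≤ x) :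
    ∫ t in Set.Ioi (x ^ (-(2 / S.alpha))), 1 / (1 + t ^ (S.alpha / 2)) = S.xi1 - S.xi2 x := by
  have h0 : (0 : ℝ) ≤ x ^ (-(2 / S.alpha)) := Real.rpow_nonneg hx _
  have h := integrableOn_xi1 hα
  rw [xi1, xi2, intervalIntegral.integral_of_le h0, ← Set.Ioc_union_Ioi_eq_Ioi h0,
    setIntegral_union Set.Ioc_disjoint_Ioi_same measurableSet_Ioi
      (h.mono_set Set.Ioc_subset_Ioi_self) (h.mono_set (Set.Ioi_subset_Ioi h0))]
  ring

lemma xi1_nonneg : 0 ≤ S.xi1 :=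
  setIntegral_nonneg measurableSet_Ioi fun _ ht => one_div_one_add_rpow_nonneg (le_of_lt ht)

lemma xi2_nonneg {x : ℝ} (hx : 0 ≤ x) : 0 ≤ S.xi2 x :=
  intervalIntegral.integral_nonneg (Real.rpow_nonneg hx _)
    fun _ ht => one_div_one_add_rpow_nonneg ht.1

variable {d : Fin N → ℝ}

lemma phi_le (hS : S.Valid) (hd : ∀ k, 0 ≤ d k) (i : Fin N) {x y z : ℝ} (hx : 0 ≤ x)
    (hy : 0 ≤ y) (hyz : y ≤ z) :
    S.phi d i x y ≤ x * (z ^ S.alpha * S.sigma0Sq) +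
      Real.pi * S.xi1 * z ^ 2 * x ^ (2 / S.alpha) * ∑ k, d k := by
  have hσ : 0 ≤ S.sigma0Sq := (div_pos hS.sigmaSq_pos hS.Pt_pos).le
  have hα : 0 ≤ S.alpha := by linarith [hS.two_lt_alpha]
  have h1 : 0 ≤ d i * S.xi2 x := mul_nonneg (hd i) (xi2_nonneg hx)
  have h2 : 0 ≤ (∑ k, d k) * S.xi1 := mul_nonneg (Finset.sum_nonneg fun k _ => hd k) xi1_nonneg
  have hpi := Real.pi_pos
  have h3 : (0 : ℝ) ≤ x ^ (2 / S.alpha) := Real.rpow_nonneg hx _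
  calc S.phi d i x y
      ≤ x * z ^ S.alpha * S.sigma0Sq +
          Real.pi * ((∑ k, d k) * S.xi1) * z ^ 2 * x ^ (2 / S.alpha) := by
        unfold phi
        gcongr
        linarith
    _ = _ := by ring

end Params

namespace Network

variable {N : ℕ} {Ω : Type*}

/-! ### The distribution of the signal to interference plus noise ratio -/

open scoped Classical in
/-- The path gain `|x| ^ (-α)` from the `p.2`-th transmitter of the file `p.1` in the configuration
`y` of transmitters, set to `0` if this transmitter does not exist or is excluded. -/
noncomputable def pathGain (α : ℝ) (i : Fin N) (r : ℝ) (y : Fin N → ℕ∞ × (ℕ → Plane))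
    (p : Fin N × ℕ) : ℝ :=
  if (p.2 : ℕ∞) < (y p.1).1 ∧ (p.1 = i → r < ‖(y p.1).2 p.2‖) then
    ‖(y p.1).2 p.2‖ ^ (-α) else 0

lemma pathGain_nonneg (α : ℝ) (i : Fin N) (r : ℝ) (y : Fin N → ℕ∞ × (ℕ → Plane))
    (p : Fin N × ℕ) : 0 ≤ pathGain α i r y p := by
  unfold pathGain
  split_ifs <;> positivity

lemma measurable_pathGain (α : ℝ) (i : Fin N) (p : Fin N × ℕ) :
    Measurable fun q : ℝ × (Fin N → ℕ∞ × (ℕ → Plane)) => pathGain α i q.1 q.2 p := by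
  classical
  unfold pathGain
  have h1 : MeasurableSet {q : ℝ × (Fin N → ℕ∞ × (ℕ → Plane)) | (p.2 : ℕ∞) < (q.2 p.1).1} :=
    (show Measurable fun q : ℝ × (Fin N → ℕ∞ × (ℕ → Plane)) => (q.2 p.1).1 by fun_prop)
      (MeasurableSet.of_discrete (s := Set.Ioi (p.2 : ℕ∞)))
  have h2 : MeasurableSet {q : ℝ × (Fin N → ℕ∞ × (ℕ → Plane)) | q.1 < ‖(q.2 p.1).2 p.2‖} :=
    measurableSet_lt (by fun_prop) (by fun_prop)
  exact Measurable.ite (h1.inter ((MeasurableSet.const _).imp h2)) (by fun_prop) measurable_const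

/-- The configuration of the transmitters of all files. -/
def config (net : Network N Ω) (ω : Ω) (k : Fin N) : ℕ∞ × (ℕ → Plane) := (net.dt k).toElement ω

open scoped Classical in
lemma pathGain_config (net : Network N Ω) (α : ℝ) (i : Fin N) (r : ℝ) (ω : Ω) (k : Fin N) (j : ℕ) :
    pathGain α i r (net.config ω) (k, j) =
      if (j : ℕ∞) < (net.dt k).count ω ∧ (k = i → r < ‖(net.dt k).pt j ω‖) then
        ‖(net.dt k).pt j ω‖ ^ (-α) else 0 := rfl

lemma interference_eq_tsum (net : Network N Ω) (S : Params N) (i : Fin N) (r : ℝ) (ω : Ω) :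
    net.interference S i r ω =
      ∑' p, ENNReal.ofReal (pathGain S.alpha i r (net.config ω) p * net.gain (some p) ω) := by
  rw [ENNReal.tsum_prod', tsum_fintype, interference]
  refine Finset.sum_congr rfl fun k _ => tsum_congr fun j => ?_
  rw [pathGain_config]
  by_cases hc : (j : ℕ∞) < (net.dt k).count ω ∧ (k = i → r < ‖(net.dt k).pt j ω‖)
  · rw [if_pos hc, if_pos hc, mul_comm]
  · rw [if_neg hc, if_neg hc, zero_mul, ENNReal.ofReal_zero]

lemma le_sinr_iff (net : Network N Ω) {S : Params N} (hS : S.Valid) (i : Fin N)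
    {t r : ℝ} (ht : 0 < t) (hr : 0 < r) (ω : Ω) :
    t ≤ net.sinr S i r ω ↔
      ENNReal.ofReal (t * r ^ S.alpha) *
          (net.interference S i r ω + ENNReal.ofReal S.sigma0Sq) ≤
        ENNReal.ofReal (net.gain none ω) := by
  have hσ : ENNReal.ofReal S.sigma0Sq ≠ 0 := by
    simpa [Params.sigma0Sq] using div_pos hS.sigmaSq_pos hS.Pt_pos
  have hra : 0 < r ^ S.alpha := Real.rpow_pos_of_pos hr _
  set B := net.interference S i r ω + ENNReal.ofReal S.sigma0Sq with hB
  have hB0 : B ≠ 0 := fun h0 => hσ (add_eq_zero.1 h0).2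
  rw [sinr, ← hB, ← ENNReal.ofReal_le_iff_le_toReal (ENNReal.div_ne_top ENNReal.ofReal_ne_top hB0),
    ENNReal.le_div_iff_mul_le (Or.inl hB0) (Or.inr ENNReal.ofReal_ne_top),
    ENNReal.ofReal_mul' (by positivity), Real.rpow_neg hr.le, ENNReal.ofReal_inv_of_pos hra,
    ← div_eq_mul_inv, ENNReal.le_div_iff_mul_le (Or.inl (by simpa using hra))
      (Or.inl ENNReal.ofReal_ne_top), ENNReal.ofReal_mul ht.le]
  rw [mul_right_comm]

section Probability

variable [MeasurableSpace Ω] {μ : Measure Ω} {net : Network N Ω} {S : Params N} {d : Fin N → ℝ}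

namespace Follows

variable (h : net.Follows S d μ)
include h

lemma measurable_config : Measurable net.config :=
  measurable_pi_lambda _ fun k => (h.dt_poisson k).measurable_count.prodMk
    (measurable_pi_lambda _ fun j => (h.dt_poisson k).measurable_pt j)

lemma density_nonneg (k : Fin N) : 0 ≤ d k := (h.dt_poisson k).density_nonneg

lemma measurable_sinr (i : Fin N) :
    Measurable fun q : ℝ × Ω => net.sinr S i q.1 q.2 := by
  unfold sinr
  simp_rw [interference_eq_tsum]
  have h1 : ∀ p, Measurable fun q : ℝ × Ω => pathGain S.alpha i q.1 (net.config q.2) p := fun p =>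
    (measurable_pathGain S.alpha i p).comp
      (measurable_fst.prodMk (h.measurable_config.comp measurable_snd))
  have h2 : ∀ o, Measurable fun q : ℝ × Ω => net.gain o q.2 := fun o =>
    (h.gain_measurable o).comp measurable_snd
  have := h2 none
  have h3 : ∀ p, Measurable fun q : ℝ × Ω => net.gain (some p) q.2 := fun p => h2 _
  fun_prop

/-- The Laplace transform of the interference, averaged over the gains, is a product of Laplace
functionals of the Poisson processes of transmitters. -/
lemma lintegral_expNeg_pathGain [IsProbabilityMeasure μ] (hS : S.Valid) (i : Fin N) {t r : ℝ}
    (ht : 0 < t) (hr : 0 < r) :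
    ∫⁻ ω, expNeg (∑' p, ENNReal.ofReal
        (Real.log (1 + t * r ^ S.alpha * pathGain S.alpha i r (net.config ω) p))) ∂μ =
      ENNReal.ofReal (Real.exp (-(Real.pi * ((∑ k, d k) * S.xi1 - d i * S.xi2 t) * r ^ 2 *
        t ^ (2 / S.alpha)))) := by
  have hα := hS.two_lt_alpha
  have hα0 : 0 < S.alpha := by linarith
  set s := t * r ^ S.alpha with hs
  have hs0 : 0 < s := mul_pos ht (Real.rpow_pos_of_pos hr _)
  let y : Fin N → ℝ := fun k => if k = i then r else 0
  have hy : ∀ k, 0 ≤ y k := fun k => by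
    simp only [y]
    split_ifs
    · exact hr.le
    · exact le_rfl
  let f : Fin N → Plane → ℝ≥0∞ := fun k x =>
    ENNReal.ofReal (Real.log (1 + s * (Set.Ioi (y k)).indicator (fun u => u ^ (-S.alpha)) ‖x‖))
  have hind : ∀ k, Measurable ((Set.Ioi (y k)).indicator fun u : ℝ => u ^ (-S.alpha)) := fun k =>
    Measurable.indicator (by fun_prop) measurableSet_Ioi
  have hf : ∀ k, Measurable (f k) := fun k => by
    have := (hind k).comp (measurable_norm (α := Plane))
    exact ENNReal.measurable_ofReal.comp (Real.measurable_log.comp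
      ((this.const_mul s).const_add 1))
  -- A transmitter of another file at the origin would count as `0 ^ (-α) = 0`, so that the
  -- condition `0 < ‖x‖` in place of no condition is harmless.
  have htot : ∀ ω, ∑' p, ENNReal.ofReal
        (Real.log (1 + s * pathGain S.alpha i r (net.config ω) p)) =
      ∑ k, (net.dt k).total (f k) ω := by
    intro ω
    rw [ENNReal.tsum_prod', tsum_fintype]
    refine Finset.sum_congr rfl fun k _ => tsum_congr fun j => ?_
    simp only [pathGain_config, f, y, Set.indicator_apply, Set.mem_Ioi]
    by_cases hj : (j : ℕ∞) < (net.dt k).count ω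
    · by_cases hk : k = i
      · subst hk
        simp [hj]
      · rcases (norm_nonneg ((net.dt k).pt j ω)).eq_or_lt with h0 | h0
        · simp [hj, hk, ← h0, Real.zero_rpow (neg_ne_zero.2 hα0.ne')]
        · simp [hj, hk, norm_pos_iff.1 h0]
    · simp [hj]
  have hindep : iIndepFun (fun k ω => expNeg ((net.dt k).total (f k) ω)) μ := by
    classical
    refine h.dt_indep.comp (fun k (e : ℕ∞ × (ℕ → Plane)) =>
      expNeg (∑' j : ℕ, if (j : ℕ∞) < e.1 then f k (e.2 j) else 0)) fun k => ?_
    refine measurable_expNeg.comp (Measurable.tsum fun j => ?_)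
    refine Measurable.ite ?_ ((hf k).comp (by fun_prop)) measurable_const
    exact measurable_fst (MeasurableSet.of_discrete (s := Set.Ioi (j : ℕ∞)))
  simp_rw [htot, expNeg_sum]
  rw [lintegral_prod_eq_prod_lintegral_of_indepFun _ _ hindep fun k =>
    measurable_expNeg.comp ((h.dt_poisson k).measurable_total (hf k))]
  have hq : ∀ k x, 1 - expNeg (f k x) = ENNReal.ofReal ((Set.Ioi (y k)).indicator
      (fun u => s * u ^ (-S.alpha) / (1 + s * u ^ (-S.alpha))) ‖x‖) := by
    intro k x
    simp only [f]
    by_cases hx : ‖x‖ ∈ Set.Ioi (y k)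
    · rw [Set.indicator_of_mem hx, Set.indicator_of_mem hx]
      have h0 : 0 ≤ s * ‖x‖ ^ (-S.alpha) := by positivity
      rw [expNeg_ofReal (Real.log_nonneg (by linarith)), ← Real.log_inv,
        Real.exp_log (by positivity), ← ENNReal.ofReal_one, ← ENNReal.ofReal_sub _ (by positivity)]
      congr 1
      field_simp
      ring
    · simp [Set.indicator_of_notMem hx]
  have hthr : ∀ k, ∫ v in Set.Ioi (s ^ (-(2 / S.alpha)) * y k ^ 2), 1 / (1 + v ^ (S.alpha / 2)) =
      S.xi1 - if k = i then S.xi2 t else 0 := by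
    intro k
    by_cases hk : k = i
    · simp only [y, if_pos hk]
      rw [← Params.integral_Ioi_eq_xi1_sub_xi2 hα ht.le]
      congr 3
      rw [hs, Real.mul_rpow ht.le (by positivity), ← Real.rpow_mul hr.le,
        show S.alpha * -(2 / S.alpha) = -(2 : ℕ) by push_cast; field_simp, Real.rpow_neg hr.le,
        Real.rpow_natCast]
      field_simp
    · simp [y, if_neg hk, Params.xi1]
  have hs2 : s ^ (2 / S.alpha) = r ^ 2 * t ^ (2 / S.alpha) := by
    rw [hs, Real.mul_rpow ht.le (by positivity), ← Real.rpow_mul hr.le,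
      show S.alpha * (2 / S.alpha) = (2 : ℕ) by push_cast; field_simp, Real.rpow_natCast]
    ring
  have hterm : ∀ k, ∫⁻ ω, expNeg ((net.dt k).total (f k) ω) ∂μ = ENNReal.ofReal (Real.exp
      (-(d k * (Real.pi * s ^ (2 / S.alpha) * (S.xi1 - if k = i then S.xi2 t else 0))))) := by
    intro k
    rw [(h.dt_poisson k).lintegral_expNeg_total (hf k)]
    simp_rw [hq k]
    have hnn : ∀ x : Plane, 0 ≤ (Set.Ioi (y k)).indicator
        (fun u => s * u ^ (-S.alpha) / (1 + s * u ^ (-S.alpha))) ‖x‖ := fun x =>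
      Set.indicator_apply_nonneg fun _ => by positivity
    rw [← ofReal_integral_eq_lintegral_ofReal (integrable_plane hα hs0 (hy k)) (ae_of_all _ hnn),
      ← ENNReal.ofReal_mul (h.density_nonneg k), expNeg_ofReal (mul_nonneg (h.density_nonneg k)
        (integral_nonneg hnn)), integral_plane hα hs0 (hy k), hthr k]
  simp_rw [hterm]
  rw [← ENNReal.ofReal_prod_of_nonneg fun k _ => (Real.exp_pos _).le, ← Real.exp_sum]
  congr 2
  rw [Finset.sum_neg_distrib]
  congr 1
  simp_rw [hs2, mul_sub, mul_ite, mul_zero]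
  rw [Finset.sum_sub_distrib, Finset.sum_ite_eq' Finset.univ i, if_pos (Finset.mem_univ i),
    ← Finset.sum_mul]
  ring

/-- **Coverage probability**: the ratio exceeds `t` with probability `e^{-φ_i(t, r)}`. -/
lemma measure_le_sinr [IsProbabilityMeasure μ] (hS : S.Valid) (i : Fin N) {t r : ℝ}
    (ht : 0 < t) (hr : 0 < r) :
    μ {ω | t ≤ net.sinr S i r ω} = ENNReal.ofReal (Real.exp (-S.phi d i t r)) := by
  have hσ : 0 ≤ S.sigma0Sq := (div_pos hS.sigmaSq_pos hS.Pt_pos).le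
  have hs : 0 ≤ t * r ^ S.alpha := by positivity
  simp_rw [net.le_sinr_iff hS i ht hr, interference_eq_tsum]
  have hpg : ∀ p, Measurable fun y : Fin N → ℕ∞ × (ℕ → Plane) => pathGain S.alpha i r y p :=
    fun p => (measurable_pathGain S.alpha i p).comp measurable_prodMk_left
  have hE : MeasurableSet {z : (Option (Fin N × ℕ) → ℝ) × (Fin N → ℕ∞ × (ℕ → Plane)) |
      ENNReal.ofReal (t * r ^ S.alpha) *
          ((∑' p, ENNReal.ofReal (pathGain S.alpha i r z.2 p * z.1 (some p))) +
            ENNReal.ofReal S.sigma0Sq) ≤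
        ENNReal.ofReal (z.1 none)} := by
    have h2 : ∀ p, Measurable fun z : (Option (Fin N × ℕ) → ℝ) × (Fin N → ℕ∞ × (ℕ → Plane)) =>
        pathGain S.alpha i r z.2 p := fun p => (hpg p).comp measurable_snd
    exact measurableSet_le (by fun_prop) (by fun_prop)
  have h1 := measure_preimage_of_indepFun (measurable_pi_lambda _ h.gain_measurable)
    h.measurable_config h.gain_dt_indep hE
  simp only [Set.mem_ofPred_eq] at h1
  rw [h1]
  simp_rw [measure_interference_le_gain h.gain_measurable h.gain_law h.gain_indep
    (fun p => pathGain_nonneg S.alpha i r _ p) hs]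
  have hm : Measurable fun ω => expNeg (∑' p, ENNReal.ofReal
      (Real.log (1 + t * r ^ S.alpha * pathGain S.alpha i r (net.config ω) p))) := by
    have h3 : ∀ p, Measurable fun ω => pathGain S.alpha i r (net.config ω) p := fun p =>
      (hpg p).comp h.measurable_config
    fun_prop
  rw [lintegral_const_mul _ hm, h.lintegral_expNeg_pathGain hS i ht hr, ← ENNReal.ofReal_mul hs,
    expNeg_ofReal (mul_nonneg hs hσ), ← ENNReal.ofReal_mul (Real.exp_pos _).le, ← Real.exp_add,
    Params.phi]
  ring_nf

end Follows

end Probability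

end Network

/-! ### The distance to the nearest point -/

namespace PointSeq

variable {Ω : Type*}

lemma nearest_lt_iff (Φ : PointSeq Ω) (ω : Ω) (a : ℝ) :
    Φ.nearest ω < ENNReal.ofReal a ↔ Φ.number (Metric.ball 0 a) ω ≠ 0 := by
  rw [nearest, number, Ne, Set.encard_eq_zero, ← Ne, ← Set.nonempty_iff_ne_empty]
  simp only [iInf_lt_iff, Set.Nonempty, Set.mem_ofPred_eq, mem_ball_zero_iff, exists_prop]
  refine exists_congr fun j => and_congr_right fun _ => ?_
  rw [ENNReal.ofReal_lt_ofReal_iff']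
  exact ⟨fun h => h.1, fun h => ⟨h, (norm_nonneg _).trans_lt h⟩⟩

namespace IsPoisson

variable [MeasurableSpace Ω] {Φ : PointSeq Ω} {d : ℝ} {μ : Measure Ω}

lemma measurable_nearest (hΦ : Φ.IsPoisson d μ) : Measurable Φ.nearest := by
  classical
  unfold nearest
  refine Measurable.iInf fun j => ?_
  have h1 : (fun ω => ⨅ (_ : (j : ℕ∞) < Φ.count ω), ENNReal.ofReal ‖Φ.pt j ω‖) =
      fun ω => if (j : ℕ∞) < Φ.count ω then ENNReal.ofReal ‖Φ.pt j ω‖ else ∞ := by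
    funext ω
    split_ifs with hj <;> simp [hj]
  rw [h1]
  have := hΦ.measurable_pt j
  exact Measurable.ite (hΦ.measurableSet_lt_count j) (by fun_prop) measurable_const

lemma measureReal_nearest_lt [IsProbabilityMeasure μ] (hΦ : Φ.IsPoisson d μ) {a : ℝ} (ha : 0 ≤ a) :
    μ.real {ω | Φ.nearest ω < ENNReal.ofReal a} = 1 - Real.exp (-(d * Real.pi * a ^ 2)) := by
  have h := hΦ.law (Metric.ball 0 a) measurableSet_ball measure_ball_lt_top.ne 0
  have hm : MeasurableSet {ω | Φ.number (Metric.ball 0 a) ω = 0} :=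
    hΦ.measurable_number measurableSet_ball (measurableSet_singleton _)
  simp_rw [nearest_lt_iff]
  rw [show {ω | Φ.number (Metric.ball 0 a) ω ≠ 0} =
      {ω | Φ.number (Metric.ball 0 a) ω = 0}ᶜ from rfl,
    probReal_compl_eq_one_sub hm]
  rw [volume_real_ball_plane ha] at h
  simp only [Nat.cast_zero, pow_zero, Nat.factorial_zero, Nat.cast_one, mul_one, div_one] at h
  rw [h, mul_assoc]

/-- The distance to the nearest point has the Rayleigh density `2 π r d e^{-d π r²}`. -/
lemma setIntegral_nearest [IsProbabilityMeasure μ] (hΦ : Φ.IsPoisson d μ) {R : ℝ} (hR : 0 ≤ R)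
    {g : ℝ → ℝ} (hg : Measurable g) :
    ∫ ω in {ω | Φ.nearest ω < ENNReal.ofReal R}, g (Φ.nearest ω).toReal ∂μ =
      ∫ r in (0 : ℝ)..R, 2 * Real.pi * r * d * Real.exp (-(d * Real.pi * r ^ 2)) * g r := by
  set A := {ω | Φ.nearest ω < ENNReal.ofReal R} with hA
  set f : ℝ → ℝ := fun r => 2 * Real.pi * r * d * Real.exp (-(d * Real.pi * r ^ 2)) with hf
  have hfc : Continuous f := by fun_prop
  have hf0 : ∀ r, 0 ≤ r → 0 ≤ f r := fun r hr => by
    have := hΦ.density_nonneg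
    have := Real.pi_pos
    positivity
  have hlt : ∀ a : ℝ, MeasurableSet {ω | Φ.nearest ω < ENNReal.ofReal a} := fun a =>
    measurableSet_lt hΦ.measurable_nearest measurable_const
  have hD : Measurable fun ω => (Φ.nearest ω).toReal := hΦ.measurable_nearest.ennreal_toReal
  have hderiv : ∀ r, HasDerivAt (fun r => -Real.exp (-(d * Real.pi * r ^ 2))) (f r) r := by
    intro r
    have h1 : HasDerivAt (fun r : ℝ => -(d * Real.pi * r ^ 2)) (-(d * Real.pi * (2 * r))) r := by
      simpa using ((hasDerivAt_pow 2 r).const_mul (d * Real.pi)).fun_neg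
    convert! h1.exp.fun_neg using 1
    simp only [hf]
    ring
  have hν : (μ.restrict A).map (fun ω => (Φ.nearest ω).toReal) =
      (volume.restrict (Set.Ioc 0 R)).withDensity fun r => ENNReal.ofReal (f r) := by
    have : IsFiniteMeasure ((μ.restrict A).map fun ω => (Φ.nearest ω).toReal) := inferInstance
    refine Measure.ext_of_Ici _ _ fun a => ?_
    -- Only the part of `[a, ∞)` in `[b, R]` carries mass.
    set b := min (max 0 a) R with hb
    have hb0 : 0 ≤ b := le_min (le_max_left _ _) hR
    have hbR : b ≤ R := min_le_right _ _
    have hleft : (fun ω => (Φ.nearest ω).toReal) ⁻¹' Set.Ici a ∩ A =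
        A \ {ω | Φ.nearest ω < ENNReal.ofReal b} := by
      ext ω
      simp only [hA, Set.mem_inter_iff, Set.mem_preimage, Set.mem_Ici, Set.mem_ofPred_eq,
        Set.mem_sdiff, not_lt]
      rw [and_comm]
      refine and_congr_right fun hω => ?_
      have hfin : Φ.nearest ω ≠ ∞ := hω.ne_top
      have hxR : (Φ.nearest ω).toReal < R := (ENNReal.lt_ofReal_iff_toReal_lt hfin).1 hω
      rw [ENNReal.ofReal_le_iff_le_toReal hfin, hb, min_le_iff, max_le_iff]
      constructor
      · exact fun h => Or.inl ⟨ENNReal.toReal_nonneg, h⟩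
      · rintro (h | h)
        · exact h.2
        · linarith
    have hright : (Set.Ioc 0 R ∩ Set.Ici a : Set ℝ) =ᵐ[volume] Set.Ioc b R := by
      filter_upwards [Measure.ae_ne volume b] with r hr
      apply propext
      change (0 < r ∧ r ≤ R) ∧ a ≤ r ↔ b < r ∧ r ≤ R
      constructor
      · rintro ⟨⟨h1, h2⟩, h3⟩
        exact ⟨lt_of_le_of_ne ((min_le_left _ _).trans (max_le h1.le h3)) hr.symm, h2⟩
      · rintro ⟨h1, h2⟩
        have h3 : max 0 a < r := by
          rcases min_lt_iff.1 h1 with h | h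
          · exact h
          · linarith
        exact ⟨⟨(le_max_left _ _).trans_lt h3, h2⟩, (le_max_right _ _).trans h3.le⟩
    have hsub : {ω | Φ.nearest ω < ENNReal.ofReal b} ⊆ A := fun ω hω =>
      lt_of_lt_of_le hω (ENNReal.ofReal_le_ofReal hbR)
    rw [Measure.map_apply hD measurableSet_Ici,
      Measure.restrict_apply (hD measurableSet_Ici), hleft, withDensity_apply _ measurableSet_Ici,
      Measure.restrict_restrict measurableSet_Ici, Set.inter_comm, setLIntegral_congr hright,
      ← ofReal_integral_eq_lintegral_ofReal
        (hfc.integrableOn_Ioc) ((ae_restrict_iff' measurableSet_Ioc).2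
          (ae_of_all _ fun r hr => hf0 r (hb0.trans hr.1.le))),
      ← intervalIntegral.integral_of_le hbR,
      intervalIntegral.integral_eq_sub_of_hasDerivAt (fun r _ => hderiv r)
        (hfc.intervalIntegrable _ _), ← ofReal_measureReal, measureReal_sdiff hsub (hlt b),
      hΦ.measureReal_nearest_lt hR, hΦ.measureReal_nearest_lt hb0]
    congr 1
    ring
  rw [← integral_map (φ := fun ω => (Φ.nearest ω).toReal) hD.aemeasurable
    hg.aestronglyMeasurable, hν, integral_withDensity_eq_integral_toReal_smul
      (hfc.measurable.ennreal_ofReal) (by simp), intervalIntegral.integral_of_le hR]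
  refine setIntegral_congr_fun measurableSet_Ioc fun r hr => ?_
  rw [ENNReal.toReal_ofReal (hf0 r hr.1.le), smul_eq_mul]

end IsPoisson

end PointSeq

/-! ### Complete and partial transmission over a link of given length -/

namespace Params

variable {N : ℕ} {S : Params N}

lemma consumption_pos (hS : S.Valid) : 0 < 1 / S.eta * S.Pt + S.Pc := by
  have := hS.eta_pos
  have := hS.Pt_pos
  have := hS.Pc_nonneg
  positivity

lemma budget_pos (hS : S.Valid) : 0 < S.budget :=
  mul_pos (mul_pos hS.rho_pos hS.V0_pos) hS.Q_pos

lemma log_one_add_Gamma1 (hS : S.Valid) :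
    Real.log (1 + S.Gamma1) =
      S.F * (1 / S.eta * S.Pt + S.Pc) * Real.log 2 / (S.W * S.budget) := by
  have := hS.eta_pos
  have := hS.W_pos
  have := hS.rho_pos
  have := hS.V0_pos
  have := hS.Q_pos
  rw [Gamma1, add_sub_cancel, Real.log_exp, budget]
  field_simp

lemma log_one_add_Gamma1_pos (hS : S.Valid) : 0 < Real.log (1 + S.Gamma1) := by
  rw [log_one_add_Gamma1 hS]
  have := consumption_pos hS
  have := hS.F_pos
  have := hS.W_pos
  have := budget_pos hS
  have := Real.log_pos one_lt_two
  positivity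

lemma Gamma1_pos (hS : S.Valid) : 0 < S.Gamma1 := by
  have h0 : 0 < 1 + S.Gamma1 := by rw [Gamma1, add_sub_cancel]; exact Real.exp_pos _
  have := (Real.log_pos_iff h0.le).1 (log_one_add_Gamma1_pos hS)
  linarith

lemma pr_nonneg (i : Fin N) : 0 ≤ S.pr i := by
  unfold pr
  positivity

lemma sum_pr_le_one : ∑ i, S.pr i ≤ 1 := by
  unfold pr
  rw [← Finset.sum_div]
  exact div_self_le_one _

end Params

namespace Network

variable {N : ℕ} {Ω : Type*}

lemma sinr_nonneg (net : Network N Ω) (S : Params N) (i : Fin N) (r : ℝ) (ω : Ω) :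
    0 ≤ net.sinr S i r ω := ENNReal.toReal_nonneg

variable {S : Params N}

lemma fraction_eq (net : Network N Ω) (hS : S.Valid) (i : Fin N) (r : ℝ) (ω : Ω) :
    net.fraction S i r ω =
      Real.log (1 + min (net.sinr S i r ω) S.Gamma1) / Real.log (1 + S.Gamma1) := by
  have h1 := Params.log_one_add_Gamma1_pos hS
  have h2 := net.sinr_nonneg S i r ω
  have h3 := Params.Gamma1_pos hS
  have hrate : net.rate S i r ω * (S.budget / (S.F * (1 / S.eta * S.Pt + S.Pc))) =
      Real.log (1 + net.sinr S i r ω) / Real.log (1 + S.Gamma1) := by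
    have := Params.consumption_pos hS
    have := Params.budget_pos hS
    have := hS.F_pos
    have := hS.W_pos
    have := Real.log_pos one_lt_two
    rw [Params.log_one_add_Gamma1 hS, rate, Real.logb]
    generalize 1 / S.eta * S.Pt + S.Pc = C at *
    field_simp
  rw [fraction, hrate]
  rcases le_total (net.sinr S i r ω) S.Gamma1 with h | h
  · rw [min_eq_left h, min_eq_left]
    rw [div_le_one h1]
    exact Real.log_le_log (by linarith) (by linarith)
  · rw [min_eq_right h, div_self h1.ne', min_eq_right]
    rw [one_le_div h1]
    exact Real.log_le_log (by linarith) (by linarith)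

lemma energy_le_iff (net : Network N Ω) (hS : S.Valid) (i : Fin N) (r : ℝ) (ω : Ω) :
    net.energy S i r ω ≤ ENNReal.ofReal S.budget ↔ S.Gamma1 ≤ net.sinr S i r ω := by
  have hC := Params.consumption_pos hS
  have hB := Params.budget_pos hS
  have hF := hS.F_pos
  have hW := hS.W_pos
  have hl2 := Real.log_pos one_lt_two
  have h0 := net.sinr_nonneg S i r ω
  have h3 := Params.Gamma1_pos hS
  have hlog : S.Gamma1 ≤ net.sinr S i r ω ↔
      S.F * (1 / S.eta * S.Pt + S.Pc) ≤ S.budget * net.rate S i r ω := by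
    rw [← add_le_add_iff_left 1, ← Real.log_le_log_iff (by linarith) (by linarith),
      Params.log_one_add_Gamma1 hS, rate, Real.logb]
    rw [div_le_iff₀ (by positivity)]
    generalize 1 / S.eta * S.Pt + S.Pc = C at *
    rw [show S.budget * (S.W * (Real.log (1 + net.sinr S i r ω) / Real.log 2)) =
      Real.log (1 + net.sinr S i r ω) * (S.W * S.budget) / Real.log 2 by ring, le_div_iff₀ hl2]
  rw [hlog, energy]
  rcases le_or_gt (net.rate S i r ω) 0 with hR | hR
  · -- At rate zero the energy is infinite.
    rw [ENNReal.ofReal_of_nonpos hR, ENNReal.div_zero (by simpa using hF),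
      ENNReal.top_mul (by simpa using hC)]
    have : S.budget * net.rate S i r ω ≤ 0 := mul_nonpos_of_nonneg_of_nonpos hB.le hR
    have : 0 < S.F * (1 / S.eta * S.Pt + S.Pc) := mul_pos hF hC
    simp only [top_le_iff, ENNReal.ofReal_ne_top, false_iff, not_le]
    linarith
  · rw [← ENNReal.ofReal_div_of_pos hR, ← ENNReal.ofReal_mul (by positivity),
      ENNReal.ofReal_le_ofReal_iff hB.le, div_mul_eq_mul_div, div_le_iff₀ hR]

lemma fraction_nonneg (net : Network N Ω) (hS : S.Valid) (i : Fin N) (r : ℝ) (ω : Ω) :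
    0 ≤ net.fraction S i r ω := by
  rw [net.fraction_eq hS]
  have h2 := net.sinr_nonneg S i r ω
  have h3 := (Params.Gamma1_pos hS).le
  exact div_nonneg (Real.log_nonneg (by linarith [le_min h2 h3]))
    (Params.log_one_add_Gamma1_pos hS).le

lemma fraction_le_one (net : Network N Ω) (i : Fin N) (r : ℝ) (ω : Ω) :
    net.fraction S i r ω ≤ 1 := min_le_right _ _

section Probability

variable [MeasurableSpace Ω] {μ : Measure Ω} {net : Network N Ω} {d : Fin N → ℝ}

namespace Follows

variable (h : net.Follows S d μ)
include h

lemma measurable_fraction (hS : S.Valid) (i : Fin N) :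
    Measurable fun q : ℝ × Ω => net.fraction S i q.1 q.2 := by
  simp_rw [net.fraction_eq hS]
  have := h.measurable_sinr i
  fun_prop

lemma measurable_meanFraction [IsProbabilityMeasure μ] (hS : S.Valid) (i : Fin N) :
    Measurable (net.meanFraction S μ i) :=
  ((h.measurable_fraction hS i).stronglyMeasurable.integral_prod_right').measurable

lemma measurable_completeProb [IsProbabilityMeasure μ] (hS : S.Valid) (i : Fin N) :
    Measurable (net.completeProb S μ i) := by
  unfold completeProb
  simp_rw [net.energy_le_iff hS, measureReal_def]
  exact (measurable_measure_prodMk_left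
    (measurableSet_le measurable_const (h.measurable_sinr i))).ennreal_toReal

lemma integrable_fraction [IsProbabilityMeasure μ] (hS : S.Valid) (i : Fin N) (r : ℝ) :
    Integrable (net.fraction S i r) μ :=
  Integrable.of_bound (h.measurable_fraction hS i).of_uncurry_left.aestronglyMeasurable
    1 (ae_of_all _ fun ω => by
      rw [Real.norm_of_nonneg (net.fraction_nonneg hS i r ω)]
      exact net.fraction_le_one i r ω)

lemma meanFraction_le_one [IsProbabilityMeasure μ] (hS : S.Valid) (i : Fin N) (r : ℝ) :
    net.meanFraction S μ i r ≤ 1 := by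
  simpa [meanFraction] using integral_mono (h.integrable_fraction hS i r)
    (integrable_const (μ := μ) (1 : ℝ)) (net.fraction_le_one i r)

lemma completeProb_le_meanFraction [IsProbabilityMeasure μ] (hS : S.Valid) (i : Fin N) (r : ℝ) :
    net.completeProb S μ i r ≤ net.meanFraction S μ i r := by
  have hm : MeasurableSet {ω | S.Gamma1 ≤ net.sinr S i r ω} :=
    measurableSet_le measurable_const (h.measurable_sinr i).of_uncurry_left
  unfold completeProb meanFraction
  simp_rw [net.energy_le_iff hS]
  have hle : ∀ ω, {ω | S.Gamma1 ≤ net.sinr S i r ω}.indicator (1 : Ω → ℝ) ω ≤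
      net.fraction S i r ω := by
    intro ω
    by_cases hω : S.Gamma1 ≤ net.sinr S i r ω
    · rw [net.fraction_eq hS, min_eq_right hω, div_self (Params.log_one_add_Gamma1_pos hS).ne',
        Set.indicator_of_mem (s := {ω | S.Gamma1 ≤ net.sinr S i r ω}) hω, Pi.one_apply]
    · rw [Set.indicator_of_notMem (s := {ω | S.Gamma1 ≤ net.sinr S i r ω}) hω]
      exact net.fraction_nonneg hS i r ω
  have hint : Integrable ({ω | S.Gamma1 ≤ net.sinr S i r ω}.indicator (1 : Ω → ℝ)) μ :=
    (integrable_const (1 : ℝ)).indicator hm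
  rw [← integral_indicator_one hm]
  exact integral_mono hint (h.integrable_fraction hS i r) hle

lemma completeProb_eq [IsProbabilityMeasure μ] (hS : S.Valid) (i : Fin N) {r : ℝ} (hr : 0 < r) :
    net.completeProb S μ i r = Real.exp (-S.phi d i S.Gamma1 r) := by
  unfold completeProb
  simp_rw [net.energy_le_iff hS]
  rw [measureReal_def, h.measure_le_sinr hS i (Params.Gamma1_pos hS) hr,
    ENNReal.toReal_ofReal (Real.exp_pos _).le]

/-- The mean fraction, by the layer cake formula `ln (1 + min(γ, Γ)) = ∫₀^Γ 1{t ≤ γ} / (1 + t) dt`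
and Fubini's theorem. -/
lemma meanFraction_eq [IsProbabilityMeasure μ] (hS : S.Valid) (i : Fin N) {r : ℝ} (hr : 0 < r) :
    net.meanFraction S μ i r = 1 / Real.log (1 + S.Gamma1) *
      ∫ t in (0 : ℝ)..S.Gamma1, Real.exp (-S.phi d i t r) / (1 + t) := by
  classical
  have hΓ := Params.Gamma1_pos hS
  have hsinr : Measurable (net.sinr S i r) := (h.measurable_sinr i).of_uncurry_left
  let f : Ω → ℝ → ℝ := fun ω t => if t ≤ net.sinr S i r ω then 1 / (1 + |t|) else 0
  have hf : Measurable (Function.uncurry f) :=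
    Measurable.ite (measurableSet_le measurable_snd (hsinr.comp measurable_fst)) (by fun_prop)
      measurable_const
  have hfi : Integrable (Function.uncurry f) (μ.prod (volume.restrict (Set.Ioc 0 S.Gamma1))) := by
    refine Integrable.of_bound hf.aestronglyMeasurable 1 (ae_of_all _ fun z => ?_)
    simp only [Function.uncurry, f]
    split_ifs
    · have := abs_nonneg z.2
      rw [Real.norm_of_nonneg (by positivity)]
      exact div_le_one_of_le₀ (by linarith) (by linarith)
    · simp
  have hlayer : ∀ ω, Real.log (1 + min (net.sinr S i r ω) S.Gamma1) =
      ∫ t in Set.Ioc 0 S.Gamma1, f ω t := by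
    intro ω
    set m := min (net.sinr S i r ω) S.Gamma1 with hm
    have hm0 : 0 ≤ m := le_min (net.sinr_nonneg S i r ω) hΓ.le
    have h1 : ∫ t in Set.Ioc 0 S.Gamma1, f ω t =
        ∫ t in Set.Ioc 0 S.Gamma1, (Set.Iic (net.sinr S i r ω)).indicator
          (fun t => 1 / (1 + t)) t := by
      refine setIntegral_congr_fun measurableSet_Ioc fun t ht => ?_
      simp only [f, Set.indicator_apply, Set.mem_Iic, abs_of_pos ht.1]
    have h2 : Set.Ioc 0 S.Gamma1 ∩ Set.Iic (net.sinr S i r ω) = Set.Ioc 0 m := by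
      ext t
      simp only [Set.mem_inter_iff, Set.mem_Ioc, Set.mem_Iic, hm, le_min_iff]
      tauto
    rw [h1, setIntegral_indicator measurableSet_Iic, h2, ← intervalIntegral.integral_of_le hm0]
    have hderiv : ∀ t ∈ Set.uIcc 0 m, HasDerivAt (fun t => Real.log (1 + t)) (1 / (1 + t)) t := by
      intro t ht
      rw [Set.uIcc_of_le hm0] at ht
      exact ((hasDerivAt_id t).const_add 1).log (by simp only [id]; linarith [ht.1])
    rw [intervalIntegral.integral_eq_sub_of_hasDerivAt hderiv]
    · simp
    · refine ContinuousOn.intervalIntegrable fun t ht => ContinuousAt.continuousWithinAt ?_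
      rw [Set.uIcc_of_le hm0] at ht
      exact ContinuousAt.div (by fun_prop) (by fun_prop) (by linarith [ht.1])
  unfold meanFraction
  simp_rw [net.fraction_eq hS, hlayer]
  rw [integral_div, integral_integral_swap hfi, intervalIntegral.integral_of_le hΓ.le, one_div,
    div_eq_inv_mul]
  congr 1
  refine setIntegral_congr_fun measurableSet_Ioc fun t ht => ?_
  have hset : MeasurableSet {ω | t ≤ net.sinr S i r ω} := measurableSet_le measurable_const hsinr
  have h1 : ∀ ω, f ω t =
      {ω | t ≤ net.sinr S i r ω}.indicator (fun _ => 1 / (1 + t)) ω := fun ω => by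
    simp only [f, Set.indicator_apply, Set.mem_ofPred_eq, abs_of_pos ht.1]
  simp only [h1]
  rw [integral_indicator_const _ hset, measureReal_def, h.measure_le_sinr hS i ht.1 hr,
    ENNReal.toReal_ofReal (Real.exp_pos _).le, smul_eq_mul, mul_one_div]

end Follows

/-! ### Averaging over the request and the length of the link -/

variable {g g' : Fin N → ℝ → ℝ}

lemma linkMean_const (net : Network N Ω) (S : Params N) (μ : Measure Ω) (c : ℝ) :
    net.linkMean S μ (fun _ _ => c) = c * net.offloadOpportunity S μ := by
  simp only [linkMean, offloadOpportunity, setIntegral_const, smul_eq_mul, Finset.mul_sum]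
  exact Finset.sum_congr rfl fun i _ => by ring

lemma offloadOpportunity_le_one (net : Network N Ω) (S : Params N) (μ : Measure Ω)
    [IsProbabilityMeasure μ] : net.offloadOpportunity S μ ≤ 1 :=
  (Finset.sum_le_sum fun i _ => mul_le_of_le_one_right (S.pr_nonneg i)
    measureReal_le_one).trans S.sum_pr_le_one

lemma abs_completeProb_le (net : Network N Ω) (S : Params N) (μ : Measure Ω)
    [IsProbabilityMeasure μ] (i : Fin N) (r : ℝ) :
    |net.completeProb S μ i r| ≤ 1 := by
  rw [completeProb, abs_of_nonneg measureReal_nonneg]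
  exact measureReal_le_one

namespace Follows

variable (h : net.Follows S d μ)
include h

lemma linkMean_eq [IsProbabilityMeasure μ] (hS : S.Valid) (hg : ∀ i, Measurable (g i)) :
    net.linkMean S μ g = ∑ i, S.pr i * ∫ r in (0 : ℝ)..S.rc, S.linkPdf i r * g i r := by
  unfold linkMean
  simp_rw [fun i => (h.helper_poisson i).setIntegral_nearest hS.rc_pos.le (hg i)]
  rfl

lemma linkMean_mono [IsProbabilityMeasure μ] (hS : S.Valid) (hg : ∀ i, Measurable (g i))
    (hg' : ∀ i, Measurable (g' i)) {M : ℝ} (hM : ∀ i r, |g i r| ≤ M) (hM' : ∀ i r, |g' i r| ≤ M)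
    (hle : ∀ i r, 0 < r → r ≤ S.rc → g i r ≤ g' i r) :
    net.linkMean S μ g ≤ net.linkMean S μ g' := by
  rw [h.linkMean_eq hS hg, h.linkMean_eq hS hg']
  have hcont : ∀ i, Continuous (S.linkPdf i) := fun i => by
    unfold Params.linkPdf
    fun_prop
  have hint : ∀ (i : Fin N) {u : ℝ → ℝ}, Measurable u → (∀ r, |u r| ≤ M) →
      IntegrableOn (fun r => S.linkPdf i r * u r) (Set.Ioc 0 S.rc) := fun i u hu hb =>
    (hcont i).integrableOn_Ioc.mul_bdd (c := M) hu.aestronglyMeasurable (ae_of_all _ hb)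
  refine Finset.sum_le_sum fun i _ => mul_le_mul_of_nonneg_left ?_ (S.pr_nonneg i)
  rw [intervalIntegral.integral_of_le hS.rc_pos.le, intervalIntegral.integral_of_le hS.rc_pos.le]
  refine setIntegral_mono_on (hint i (hg i) (hM i)) (hint i (hg' i) (hM' i)) measurableSet_Ioc
    fun r hr => mul_le_mul_of_nonneg_left (hle i r hr.1 hr.2) ?_
  have := mul_nonneg hS.lam_pos.le (hS.pc_nonneg i)
  have := Real.pi_pos
  have := hr.1.le
  unfold Params.linkPdf Params.lamFile
  positivity

lemma abs_meanFraction_le [IsProbabilityMeasure μ] (hS : S.Valid) (i : Fin N) (r : ℝ) :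
    |net.meanFraction S μ i r| ≤ 1 := by
  rw [meanFraction, abs_of_nonneg (integral_nonneg fun ω => net.fraction_nonneg hS i r ω)]
  exact h.meanFraction_le_one hS i r

lemma offloadProbability_le_offloadRatio [IsProbabilityMeasure μ] (hS : S.Valid) :
    net.offloadProbability S μ ≤ net.offloadRatio S μ :=
  h.linkMean_mono hS (h.measurable_completeProb hS) (h.measurable_meanFraction hS)
    (net.abs_completeProb_le S μ) (h.abs_meanFraction_le hS)
    fun i r _ _ => h.completeProb_le_meanFraction hS i r

lemma offloadRatio_le_offloadOpportunity [IsProbabilityMeasure μ] (hS : S.Valid) :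
    net.offloadRatio S μ ≤ net.offloadOpportunity S μ := by
  have h1 := net.linkMean_const S μ 1
  rw [one_mul] at h1
  rw [← h1]
  exact h.linkMean_mono hS (h.measurable_meanFraction hS) (fun _ => measurable_const)
    (h.abs_meanFraction_le hS) (by simp) fun i r _ _ => h.meanFraction_le_one hS i r

lemma offloadRatio_eq [IsProbabilityMeasure μ] (hS : S.Valid) :
    net.offloadRatio S μ =
      ∑ i, S.pr i * ∫ r in (0 : ℝ)..S.rc, S.linkPdf i r / Real.log (1 + S.Gamma1) *
        ∫ t in (0 : ℝ)..S.Gamma1, Real.exp (-S.phi d i t r) / (1 + t) := by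
  rw [offloadRatio, h.linkMean_eq hS (h.measurable_meanFraction hS)]
  refine Finset.sum_congr rfl fun i _ => ?_
  rw [intervalIntegral.integral_of_le hS.rc_pos.le, intervalIntegral.integral_of_le hS.rc_pos.le]
  congr 1
  refine setIntegral_congr_fun measurableSet_Ioc fun r hr => ?_
  rw [h.meanFraction_eq hS i hr.1]
  ring

/-- Since `1 - e^{-φ} ≤ φ`, the offloading probability falls short of the offloading opportunity
by at most the largest value of `φ_i(Γ₁, r)` for `r ≤ r_c`. -/
lemma offloadOpportunity_sub_offloadProbability_le [IsProbabilityMeasure μ] (hS : S.Valid) :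
    net.offloadOpportunity S μ - net.offloadProbability S μ ≤
      S.Gamma1 * (S.rc ^ S.alpha * S.sigma0Sq) +
        Real.pi * S.xi1 * S.rc ^ 2 * S.Gamma1 ^ (2 / S.alpha) * ∑ k, d k := by
  have hΓ := Params.Gamma1_pos hS
  set K := S.Gamma1 * (S.rc ^ S.alpha * S.sigma0Sq) +
    Real.pi * S.xi1 * S.rc ^ 2 * S.Gamma1 ^ (2 / S.alpha) * ∑ k, d k with hK
  have hK0 : 0 ≤ K := by
    have hσ : 0 ≤ S.sigma0Sq := (div_pos hS.sigmaSq_pos hS.Pt_pos).le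
    have := hS.rc_pos
    have := Real.pi_pos
    have := S.xi1_nonneg
    have : 0 ≤ ∑ k, d k := Finset.sum_nonneg fun k _ => h.density_nonneg k
    positivity
  have h1 : net.linkMean S μ (fun _ _ => 1 - K) ≤ net.offloadProbability S μ := by
    refine h.linkMean_mono hS (fun _ => measurable_const) (h.measurable_completeProb hS)
      (M := 1 + K) (fun _ _ => ?_)
      (fun i r => (net.abs_completeProb_le S μ i r).trans (by linarith))
      fun i r hr hrc => ?_
    · rw [abs_le]
      constructor <;> linarith
    · rw [h.completeProb_eq hS i hr]
      have h2 := Real.add_one_le_exp (-S.phi d i S.Gamma1 r)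
      have h3 := Params.phi_le hS h.density_nonneg i hΓ.le hr.le hrc
      linarith
  rw [linkMean_const] at h1
  have h4 := net.offloadOpportunity_le_one S μ
  nlinarith

end Follows

end Probability

end Network

/-! ### The limits -/

namespace Params

variable {N : ℕ} {S : Params N}

lemma Valid.with_rho (hS : S.Valid) {ρ : ℝ} (hρ : 0 < ρ) : Valid { S with rho := ρ } :=
  ⟨hS.lam_pos, hS.pc_nonneg, hS.pc_sum, hS.rc_pos, hS.two_lt_alpha, hS.F_pos, hS.W_pos, hS.Q_pos,
    hS.V0_pos, hS.eta_pos, hS.Pt_pos, hS.Pc_nonneg, hS.sigmaSq_pos, hρ⟩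

lemma tendsto_Gamma1 (hS : S.Valid) :
    Tendsto (fun ρ : ℝ => Params.Gamma1 { S with rho := ρ }) atTop (𝓝 0) := by
  have hden : Tendsto (fun ρ : ℝ => S.W * ρ * S.Q * S.V0 * S.eta) atTop atTop :=
    (((tendsto_id.const_mul_atTop hS.W_pos).atTop_mul_const hS.Q_pos).atTop_mul_const
      hS.V0_pos).atTop_mul_const hS.eta_pos
  have h1 := (Real.continuous_exp.tendsto 0).comp
    (hden.const_div_atTop (S.F * (S.Pt + S.eta * S.Pc) * Real.log 2))
  simpa [Gamma1, Function.comp_def] using h1.sub_const 1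

end Params

namespace Network.Follows

variable {N : ℕ} {Ω : Type*} [MeasurableSpace Ω] {μ : Measure Ω} {net : Network N Ω}
  {S : Params N} {d : Fin N → ℝ}

lemma with_rho (h : net.Follows S d μ) (ρ : ℝ) : net.Follows { S with rho := ρ } d μ :=
  ⟨h.helper_poisson, h.dt_poisson, h.dt_indep, h.gain_measurable, h.gain_law, h.gain_indep,
    h.gain_dt_indep⟩

/-- As `ρ → ∞` the threshold `Γ₁` tends to `0`, and with it the gap between the offloading
opportunity and the offloading probability. -/
lemma tendsto_offloadProbability [IsProbabilityMeasure μ] (h : net.Follows S d μ) (hS : S.Valid) :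
    Tendsto (fun ρ : ℝ => net.offloadProbability { S with rho := ρ } μ) atTop
      (𝓝 (net.offloadOpportunity S μ)) := by
  have hα : 0 < 2 / S.alpha := div_pos two_pos (two_pos.trans hS.two_lt_alpha)
  have hΓ := Params.tendsto_Gamma1 hS
  have hlow : Tendsto (fun ρ : ℝ => net.offloadOpportunity S μ -
      (Params.Gamma1 { S with rho := ρ } * (S.rc ^ S.alpha * S.sigma0Sq) +
        Real.pi * S.xi1 * S.rc ^ 2 * Params.Gamma1 { S with rho := ρ } ^ (2 / S.alpha) *
          ∑ k, d k)) atTop (𝓝 (net.offloadOpportunity S μ)) := by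
    have h1 : Tendsto (fun ρ : ℝ => Params.Gamma1 { S with rho := ρ } ^ (2 / S.alpha)) atTop
        (𝓝 0) := by
      simpa [Real.zero_rpow hα.ne'] using hΓ.rpow_const (p := 2 / S.alpha) (Or.inr hα.le)
    simpa using tendsto_const_nhds.sub ((hΓ.mul_const (S.rc ^ S.alpha * S.sigma0Sq)).add
      ((h1.const_mul (Real.pi * S.xi1 * S.rc ^ 2)).mul_const (∑ k, d k)))
  refine tendsto_of_tendsto_of_tendsto_of_le_of_le' hlow tendsto_const_nhds ?_ ?_
  · filter_upwards [eventually_gt_atTop 0] with ρ hρ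
    have := (h.with_rho ρ).offloadOpportunity_sub_offloadProbability_le (hS.with_rho hρ)
    exact sub_le_comm.1 this
  · filter_upwards [eventually_gt_atTop 0] with ρ hρ
    exact ((h.with_rho ρ).offloadProbability_le_offloadRatio (hS.with_rho hρ)).trans
      ((h.with_rho ρ).offloadRatio_le_offloadOpportunity (hS.with_rho hρ))

end Network.Follows

end D2D

theorem proposition4 {N : ℕ} (S : D2D.Params N) (hS : S.Valid) :
    -- the formula, the inequalities and the limit of unlimited battery,
    -- for the densities of transmitters that the protocol produces
    (∀ (Ω : Type*) [MeasurableSpace Ω] (μ : Measure Ω) [IsProbabilityMeasure μ]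
        (net : D2D.Network N Ω), net.Follows S S.dtDensity μ →
      net.offloadRatio S μ =
          ∑ i, S.pr i * ∫ r in (0 : ℝ)..S.rc, S.linkPdf i r / Real.log (1 + S.Gamma1) *
            ∫ t in (0 : ℝ)..S.Gamma1, Real.exp (-S.phi S.dtDensity i t r) / (1 + t) ∧
      net.offloadProbability S μ ≤ net.offloadRatio S μ ∧
      net.offloadRatio S μ ≤ net.offloadOpportunity S μ ∧
      Tendsto (fun ρ : ℝ => net.offloadProbability { S with rho := ρ } μ) atTop
          (𝓝 (net.offloadOpportunity S μ)) ∧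
      Tendsto (fun ρ : ℝ => net.offloadRatio { S with rho := ρ } μ) atTop
          (𝓝 (net.offloadOpportunity S μ))) ∧
    -- the limit of infinite SNR and vanishing density of transmitters, uniformly in the user density,
    -- the popularity, the caching distribution and the way in which the transmitters are distributed
    -- over the files (any `d ≥ 0`, in particular `S'.dtDensity`)
    (∀ ε : ℝ, 0 < ε → ∃ δ : ℝ, 0 < δ ∧
      ∀ (β lam s : ℝ) (pc d : Fin N → ℝ) (S' : D2D.Params N),
        S' = { S with beta := β, lam := lam, pc := pc, sigmaSq := s } → S'.Valid →
        (∀ k, 0 ≤ d k) → S'.rc ^ S'.alpha * S'.sigma0Sq < δ → ∑ k, d k < δ →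
        ∀ (Ω : Type*) [MeasurableSpace Ω] (μ : Measure Ω) [IsProbabilityMeasure μ]
          (net : D2D.Network N Ω), net.Follows S' d μ →
        |net.offloadOpportunity S' μ - net.offloadProbability S' μ| < ε ∧
        |net.offloadOpportunity S' μ - net.offloadRatio S' μ| < ε) := by
  refine ⟨fun Ω _ μ _ net h => ⟨h.offloadRatio_eq hS, h.offloadProbability_le_offloadRatio hS,
    h.offloadRatio_le_offloadOpportunity hS, h.tendsto_offloadProbability hS, ?_⟩, fun ε hε => ?_⟩
  · refine tendsto_of_tendsto_of_tendsto_of_le_of_le' (h.tendsto_offloadProbability hS)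
      tendsto_const_nhds ?_ ?_
    · filter_upwards [eventually_gt_atTop 0] with ρ hρ
      exact (h.with_rho ρ).offloadProbability_le_offloadRatio (hS.with_rho hρ)
    · filter_upwards [eventually_gt_atTop 0] with ρ hρ
      exact (h.with_rho ρ).offloadRatio_le_offloadOpportunity (hS.with_rho hρ)
  · have hΓ := D2D.Params.Gamma1_pos hS
    set A := Real.pi * S.xi1 * S.rc ^ 2 * S.Gamma1 ^ (2 / S.alpha) with hA
    have hA0 : 0 ≤ A := by
      have := Real.pi_pos
      have := S.xi1_nonneg
      positivity
    -- The bound `Γ₁ δ + A δ` on the gap involves none of the quantities that vary.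
    refine ⟨ε / (S.Gamma1 + A), by positivity, ?_⟩
    rintro β lam s pc d S' rfl hS' - hsnr hsum Ω _ μ _ net h
    have h1 := h.offloadOpportunity_sub_offloadProbability_le hS'
    have h2 := h.offloadProbability_le_offloadRatio hS'
    have h3 := h.offloadRatio_le_offloadOpportunity hS'
    have h4 := mul_lt_mul_of_pos_left hsnr hΓ
    have h5 := mul_le_mul_of_nonneg_left hsum.le hA0
    have h6 : S.Gamma1 * (ε / (S.Gamma1 + A)) + A * (ε / (S.Gamma1 + A)) = ε := by
      field_simp
    have h7 := h1.trans_lt ((add_lt_add_of_lt_of_le h4 h5).trans_eq h6)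
    rw [abs_of_nonneg (by linarith), abs_of_nonneg (by linarith)]
    exact ⟨h7, by linarith⟩
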